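/- Let $\mathbb F_q$ be the finite field with $q$ elements, let $m\ge 1$, $1\le d\le m(q-1)$, and write $d-1=\nu(q-1)+\mu$ with $0\le\mu<q-1$. Notation. For $j\ge 0$ let $P^j\subset\mathbb F_q^{j+1}$ be the set of vectors whose leftmost nonzero coordinate is $1$ (representatives of the points of the projective space $\mathbb P^j$ over $\mathbb F_q$). The affine Reed–Muller code $\mathrm{RM}_e(j)$ consists of the evaluations $\mathrm{ev}_{\mathbb A^j}(f)$ at all points of $\mathbb F_q^j$ of the polynomials $f$ in $j$ variables of degree at most $e$; the projective Reed–Muller code $\mathrm{PRM}_e(j)$ consists of the evaluations $\mathrm{ev}_{\mathbb P^j}(f)$ at all points of $P^j$ of the homogeneous polynomials $f$ of degree $e$ in $j+1$ variables. For a vector, $\mathrm{wt}$ is the Hamming weight, and for a code, $\mathrm{wt}$ is the minimum distance. Put $$\eta_d(m):=\Big(\sum_{i=0}^{m-\nu-1}\mathrm{wt}(\mathrm{RM}_d(m-i))\Big)+1 .$$ Then: 1. $\displaystyle \eta_d(m)=(q-\mu)q^{m-\nu-1}-\mu\,\frac{q^{m-\nu-1}-1}{q-1}=\mathrm{wt}(\mathrm{PRM}_d(m))-\mu\,\frac{q^{m-\nu-1}-1}{q-1}.$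 2. $\eta_d(m)\le \mathrm{wt}(\mathrm{PRM}_d(m))$, with equality if and only if $\mu=0$ or $\nu=m-1$. 3. If $\mu=0$ or $\nu=m-1$, the recursive decoder $D_d(m)$ described below decodes $\mathrm{PRM}_d(m)$ up to its full error correction capability: for every $c\in\mathrm{PRM}_d(m)$ and every vector $e$ with $\mathrm{wt}(e)\le\lfloor(\mathrm{wt}(\mathrm{PRM}_d(m))-1)/2\rfloor$, the output of $D_d(m)$ on $c+e$ is a pair $(c,f)$, where $f$ is homogeneous of degree $d$ and $\mathrm{ev}_{\mathbb P^m}(f)=c$. The decoder. It uses arbitrary given decoders $A_e(j)$ for the codes $\mathrm{RM}_e(j)$, $1\le j\le m$, $0\le e\le d$, about which the following is assumed: on every input, $A_e(j)$ returns either an error or a pair $(c,f)$ with $\deg f\le e$ and $c=\mathrm{ev}_{\mathbb A^j}(f)$; and on an input $c+e'$ with $c\in \mathrm{RM}_e(j)$ and $\mathrm{wt}(e')<\mathrm{wt}(\mathrm{RM}_e(j))/2$ it returns a pair whose first entry is $c$. On input $r$, indexed by $P^m$, with $t=\mathrm{wt}(\mathrm{PRM}_d(m))/2$, the decoder $D_d(m)$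 ($m\ge 0$, $d\geq 1$) works as follows; an error in a decoder that it calls is an error of the part in which the call is made. * If $t\le 1$ (in particular if $m=0$), return $(r,f)$ with some homogeneous $f$ of degree $d$ such that $\mathrm{ev}_{\mathbb P^m}(f)=r$, and an error if there is none. * Otherwise split $r=(r_1,r_2)$ along $P^m=(\{1\}\times\mathbb F_q^m)\cup(\{0\}\times P^{m-1})$. * First part. Let $(c_1,f^0)$ be the output of $A_d(m)$ on $r_1$. If $d\le q-1$, put $f=h(f^0)$ and $c=\mathrm{ev}_{\mathbb P^m}(f)$, where $h(g)=x_0^d\,g(x_1/x_0,\dots,x_m/x_0)$. If $d\ge q$, call a monomial bad if its degree is positive, less than $d$ and congruent to $d$ modulo $q-1$; let $f^0_{bad}$ be the sum of the terms of $f^0$ at bad monomials, let $g$ be the degree-$d$ part of $f^0-f^0_{bad}$, and $c_{good}=\mathrm{ev}_{\mathbb P^{m-1}}(g)$. Let $(c_{bad},f')$ be the output of $D_{d-(q-1)}(m-1)$ on $r_2-c_{good}$. Let $g^0$ be the reduction of $f^0-f'-g$ modulo the polynomials $x_i^q-x_i$, and let $f'_d$ be obtained from $f'$ by multiplying each monomial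 by $x_i^{q-1}$, where $x_i$ is its first variable. Put $f=h(g^0)+f'_d+g$ and $c=(c_1,c_{good}+c_{bad})$. In both cases, if $\mathrm{wt}(r-c)<t$, return $(c,f)$ and stop. * Second part (if the first part has not returned a pair). Let $(v,g)$ be the output of $D_d(m-1)$ on $r_2$. Let $v_{\xi,d}$ be the vector indexed by $\mathbb F_q^m$ with value $0$ at $0$ and value $\lambda^d v_P$ at $\lambda P$, for $\lambda\in\mathbb F_q^*$ and $P\in P^{m-1}$. Let $(u,f^0)$ be the output of $A_{d-1}(m)$ on $r_1-v_{\xi,d}$. Return $(u+v_{\xi,d},v)$ as codeword, together with $h(f^0)+g$. -/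

import Mathlib

namespace ProjReedMuller

open MvPolynomial

noncomputable section

/-! ### Points and words -/

/-- The leftmost nonzero coordinate of a vector (`0` for the zero vector). -/
def lead {F : Type*} [Field F] [DecidableEq F] : {n : ℕ} → (Fin n → F) → F
  | 0, _ => 0
  | _ + 1, x => if x 0 = 0 then lead (Fin.tail x) else x 0

theorem lead_cons {F : Type*} [Field F] [DecidableEq F] {n : ℕ} (a : F) (x : Fin n → F) :
    lead (Fin.cons a x : Fin (n + 1) → F) = if a = 0 then lead x else a := by
  simp [lead]

theorem lead_smul {F : Type*} [Field F] [DecidableEq F] {n : ℕ} (a : F) (x : Fin n → F) :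
    lead (a • x) = a * lead x := by
  induction n with
  | zero => simp [lead]
  | succ n ih =>
    have h : Fin.tail (a • x) = a • Fin.tail x := rfl
    by_cases hx : x 0 = 0
    · simp [lead, h, ih, hx]
    · by_cases ha : a = 0
      · simp only [lead, h, ih]
        simp [ha]
      · simp [lead, hx, ha]

theorem lead_ne_zero {F : Type*} [Field F] [DecidableEq F] {n : ℕ} {x : Fin n → F}
    (hx : x ≠ 0) : lead x ≠ 0 := by
  induction n with
  | zero => exact absurd (Subsingleton.elim x 0) hx
  | succ n ih =>
    by_cases h0 : x 0 = 0
    · simp only [lead, h0, if_true]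
      refine ih fun ht => hx ?_
      funext i
      refine Fin.cases h0 (fun k => ?_) i
      exact congrFun ht k
    · simp [lead, h0]

/-- The standard representatives `P^j` of the points of the projective space of dimension `j`:
vectors of length `j + 1` whose leftmost nonzero coordinate is `1`. -/
abbrev ProjPt (F : Type*) [Field F] [DecidableEq F] (j : ℕ) : Type _ :=
  {x : Fin (j + 1) → F // lead x = 1}

/-- Vectors of length `q ^ j`, with coordinates indexed by the points of `F ^ j`. -/
abbrev AffWord (F : Type*) (j : ℕ) : Type _ := (Fin j → F) → F

/-- Vectors of length `|P^j|`, with coordinates indexed by the points of `P^j`. -/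
abbrev ProjWord (F : Type*) [Field F] [DecidableEq F] (j : ℕ) : Type _ := ProjPt F j → F

/-- The minimum distance of a nonzero linear code: the least weight of a nonzero codeword. -/
def minDist {F ι : Type*} [Field F] [DecidableEq F] [Fintype ι] (C : Submodule F (ι → F)) : ℕ :=
  sInf {w : ℕ | ∃ c ∈ C, c ≠ 0 ∧ hammingNorm c = w}

/-! ### The codes -/

/-- Evaluation of polynomials at all points of `F ^ j`. -/
def evA (F : Type*) [Field F] (j : ℕ) : MvPolynomial (Fin j) F →ₗ[F] AffWord F j where
  toFun f := fun Q => eval Q f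
  map_add' f g := by funext Q; simp
  map_smul' a f := by funext Q; simp

/-- Evaluation of polynomials at the standard representatives of the projective points. -/
def evP (F : Type*) [Field F] [DecidableEq F] (j : ℕ) :
    MvPolynomial (Fin (j + 1)) F →ₗ[F] ProjWord F j where
  toFun f := fun Q => eval Q.1 f
  map_add' f g := by funext Q; simp
  map_smul' a f := by funext Q; simp

/-- The affine Reed-Muller code `RM_d(j)`. -/
def RM (F : Type*) [Field F] (d j : ℕ) : Submodule F (AffWord F j) :=
  (restrictTotalDegree (Fin j) F d).map (evA F j)

/-- The projective Reed-Muller code `PRM_d(j)`. -/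
def PRM (F : Type*) [Field F] [DecidableEq F] (d j : ℕ) : Submodule F (ProjWord F j) :=
  (homogeneousSubmodule (Fin (j + 1)) F d).map (evP F j)

/-- `η_d(m) = ∑_{i=0}^{m-ν-1} wt(RM_d(m-i)) + 1`, where `ν` is the quotient of `d - 1`
by `q - 1`. -/
def eta (F : Type*) [Field F] [Fintype F] [DecidableEq F] (d m : ℕ) : ℕ :=
  (∑ i ∈ Finset.range (m - (d - 1) / (Fintype.card F - 1)), minDist (RM F d (m - i))) + 1

/-! ### Operations on polynomials -/

/-- Homogenization up to degree `d` with respect to a new variable `x_0`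
(for `f` of degree at most `d`): `x_0 ^ d * f(x_1 / x_0, …, x_n / x_0)`. -/
def homog {F : Type*} [Field F] {n : ℕ} (d : ℕ) (f : MvPolynomial (Fin n) F) :
    MvPolynomial (Fin (n + 1)) F :=
  ∑ α ∈ f.support, monomial (Finsupp.cons (d - α.degree) α) (f.coeff α)

/-- A monomial is bad if its degree is positive, less than `d`, and congruent to `d`
modulo `q - 1`; `badPart d f` is the sum of the terms of `f` at bad monomials. -/
def badPart {F : Type*} [Field F] [Fintype F] {n : ℕ} (d : ℕ) (f : MvPolynomial (Fin n) F) :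
    MvPolynomial (Fin n) F :=
  ∑ α ∈ f.support with
    0 < α.degree ∧ α.degree < d ∧ α.degree ≡ d [MOD (Fintype.card F - 1)],
    monomial α (f.coeff α)

/-- The sum of the terms of degree `d` of the good part `f - badPart d f` of `f`. -/
def goodTop {F : Type*} [Field F] [Fintype F] {n : ℕ} (d : ℕ) (f : MvPolynomial (Fin n) F) :
    MvPolynomial (Fin n) F :=
  homogeneousComponent d (f - badPart d f)

/-- The reduced representative of `f` modulo the polynomials `x_i ^ q - x_i`: a positive exponent
`a` is replaced by the number in `{1, …, q - 1}` that is congruent to it modulo `q - 1`. -/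
def reduce {F : Type*} [Field F] [Fintype F] {n : ℕ} (f : MvPolynomial (Fin n) F) :
    MvPolynomial (Fin n) F :=
  ∑ α ∈ f.support, monomial
    (α.mapRange (fun a => if a = 0 then 0 else (a - 1) % (Fintype.card F - 1) + 1) (by simp))
    (f.coeff α)

/-- In every nonconstant monomial of degree at most `d`, the exponent of the first variable that
occurs is increased so that the monomial gets degree `d`. -/
def raise {F : Type*} [Field F] {n : ℕ} (d : ℕ) (f : MvPolynomial (Fin n) F) :
    MvPolynomial (Fin n) F :=
  ∑ α ∈ f.support, monomial
    (if h : α.support.Nonempty then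
      α + Finsupp.single (α.support.min' h) (d - α.degree) else α)
    (f.coeff α)

/-! ### Operations on words, along `P^{m+1} = ({1} × F^{m+1}) ∪ ({0} × P^m)` -/

/-- The part of a word at the points of `{1} × F^{m+1}`. -/
def fstPart {F : Type*} [Field F] [DecidableEq F] {m : ℕ} (r : ProjWord F (m + 1)) :
    AffWord F (m + 1) :=
  fun Q => r ⟨Fin.cons 1 Q, by simp [lead_cons]⟩

/-- The part of a word at the points of `{0} × P^m`. -/
def sndPart {F : Type*} [Field F] [DecidableEq F] {m : ℕ} (r : ProjWord F (m + 1)) :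
    ProjWord F m :=
  fun P => r ⟨Fin.cons 0 P.1, by simp [lead_cons, P.2]⟩

/-- The word `(a, b)` with the given parts. -/
def glue {F : Type*} [Field F] [DecidableEq F] {m : ℕ} (a : AffWord F (m + 1))
    (b : ProjWord F m) : ProjWord F (m + 1) :=
  fun x => if h : x.1 0 = 0 then b ⟨Fin.tail x.1, by have := x.2; simpa [lead, h] using this⟩
    else a (Fin.tail x.1)

/-- The vector `v_{ξ,d} = (v, ξ^d v, …, ξ^{(q-2)d} v, 0)`, where `ξ` is a primitive element and
`F^{m+1}` is the union of the `ξ^r • P^m`, `0 ≤ r ≤ q - 2`, and `{0}`.  Its value at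
`Q = ξ^r • P` is `ξ^{rd} * v P`, and `ξ^r` is the leftmost nonzero coordinate of `Q`. -/
def spread {F : Type*} [Field F] [DecidableEq F] {m : ℕ} (d : ℕ) (v : ProjWord F m) :
    AffWord F (m + 1) :=
  fun Q => if h : Q = 0 then 0 else
    lead Q ^ d * v ⟨(lead Q)⁻¹ • Q, by rw [lead_smul, inv_mul_cancel₀ (lead_ne_zero h)]⟩

/-! ### The decoder -/

/-- A decoder for `RM_d(j)`: it maps a received word to an error (`none`), or to a codeword `c`
together with a polynomial `f` of degree at most `d` with evaluation `c`. -/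
abbrev AffDecoder (F : Type*) [Field F] (j : ℕ) : Type _ :=
  AffWord F j → Option (AffWord F j × MvPolynomial (Fin j) F)

/-- A decoder for `PRM_d(m)`: it maps a received word to an error, or to a codeword together
with a homogeneous polynomial. -/
abbrev ProjDecoder (F : Type*) [Field F] [DecidableEq F] (m : ℕ) : Type _ :=
  ProjWord F m → Option (ProjWord F m × MvPolynomial (Fin (m + 1)) F)

/-- `D` is a decoder for `RM_d(j)` up to the error correction capability of this code:
what it returns is a codeword with a polynomial, and it recovers `c` from `c + e`
if `wt(e) < wt(RM_d(j)) / 2`. -/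
structure IsRMDecoder {F : Type*} [Field F] [Fintype F] [DecidableEq F] (d j : ℕ)
    (D : AffDecoder F j) : Prop where
  returns : ∀ r c f, D r = some (c, f) → f.totalDegree ≤ d ∧ evA F j f = c
  corrects : ∀ c ∈ RM F d j, ∀ e : AffWord F j,
    2 * hammingNorm e < minDist (RM F d j) → ∃ f, D (c + e) = some (c, f)

open Classical in
/-- Return `r` with a homogeneous polynomial of degree `d` with evaluation `r`; return an error
if there is none. -/
def direct {F : Type*} [Field F] [DecidableEq F] (m d : ℕ) : ProjDecoder F m :=
  fun r => if h : ∃ f : MvPolynomial (Fin (m + 1)) F, f.IsHomogeneous d ∧ evP F m f = r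
    then some (r, h.choose) else none

/-- The first part of the recursive algorithm for `PRM_d(m+1)`, without its final test.
`A` is the decoder for `RM_d(m+1)`, and `P` is the one for `PRM_{d-(q-1)}(m)`. -/
def firstPart {F : Type*} [Field F] [Fintype F] [DecidableEq F] {m : ℕ} (d : ℕ)
    (A : AffDecoder F (m + 1)) (P : ProjDecoder F m) : ProjDecoder F (m + 1) :=
  fun r => (A (fstPart r)).bind fun x =>
    let c₁ := x.1
    let f₀ := x.2
    if d ≤ Fintype.card F - 1 then
      let f := homog d f₀
      some (evP F (m + 1) f, f)
    else
      let top := goodTop d f₀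
      let cgood := evP F m top
      (P (sndPart r - cgood)).bind fun y =>
        let cbad := y.1
        let fbad := y.2
        let g₀ := reduce (f₀ - fbad - top)
        let f := homog d g₀ + rename Fin.succ (raise d fbad) + rename Fin.succ top
        some (glue c₁ (cgood + cbad), f)

/-- The second part of the recursive algorithm for `PRM_d(m+1)`.
`A` is the decoder for `RM_{d-1}(m+1)`, and `P` is the one for `PRM_d(m)`. -/
def secondPart {F : Type*} [Field F] [DecidableEq F] {m : ℕ} (d : ℕ)
    (A : AffDecoder F (m + 1)) (P : ProjDecoder F m) : ProjDecoder F (m + 1) :=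
  fun r => (P (sndPart r)).bind fun x =>
    let v := x.1
    let g := x.2
    (A (fstPart r - spread d v)).bind fun y =>
      let u := y.1
      let f := y.2
      some (glue (u + spread d v) v, homog d f + rename Fin.succ g)

/-- The recursive algorithm, given a family of decoders `D j e` for the codes `RM_e(j)`.
With `t = wt(PRM_d(m)) / 2`: if `t ≤ 1` (which is always the case for `m = 0`), the received word
`r` is returned; otherwise the result `(c, f)` of the first part is returned if there is one and
`wt(r - c) < t`, and in all other cases the result of the second part is. -/
def decode {F : Type*} [Field F] [Fintype F] [DecidableEq F]
    (D : (j e : ℕ) → AffDecoder F j) : (m d : ℕ) → ProjDecoder F m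
  | 0, d => direct 0 d
  | m + 1, d => fun r =>
    if minDist (PRM F d (m + 1)) ≤ 2 then direct (m + 1) d r
    else
      match firstPart d (D (m + 1) d) (decode D m (d - (Fintype.card F - 1))) r with
      | some (c, f) =>
        if 2 * hammingNorm (r - c) < minDist (PRM F d (m + 1)) then some (c, f)
        else secondPart d (D (m + 1) (d - 1)) (decode D m d) r
      | none => secondPart d (D (m + 1) (d - 1)) (decode D m d) r

end

end ProjReedMuller

open ProjReedMuller

namespace ProjReedMuller

open MvPolynomial

/-! Everything rests on two minimum distances. For affine codes (`minDist_RM`), slice a word along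
the hyperplanes `x_0 = a`: each slice that vanishes lets a linear factor be divided off, which
lowers the degree on the remaining slices. For projective codes (`minDist_PRM`), `PRM_{d+1}(n)` has
the same distance as `RM_d(n)`. A form vanishing on some hyperplane becomes, after a linear change
of coordinates, a polynomial of degree at most `d` on the affine complement. A form vanishing on no
hyperplane is bounded by induction on the hyperplanes and double counting. With these values `η` is
a geometric sum, and its defect `μ (q^M - 1)/(q - 1)`, where `M = m - ν - 1`, vanishes exactly when
`μ = 0` or `M = 0`.

In that case `rmWeight_le_add` says that `wt(PRM_d(m)) ≤ wt(RM_d(m)) + wt(PRM_d(m-1))`. So a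
correctable error is correctable either in its affine part by `RM_d(m)`, or at infinity by
`PRM_d(m-1)`. In the first case the affine polynomial determines the values at infinity up to a word
of `PRM_{d-(q-1)}(m-1)` (`exists_isHomogeneous_eval_homogeneousComponent`). This code has the
distance of `PRM_d(m)`, so recursion removes the error at infinity (`firstPart_corrects`). In the
second case, subtracting the homogeneous extension of the part at infinity leaves a word of
`RM_{d-1}(m)`, again of the distance of `PRM_d(m)` (`secondPart_corrects`). A wrong result of the
first part cannot pass the final test, because everything returned is a codeword
(`firstPart_isSound`, `eq_of_hammingNorm_lt`). -/

/-! ### Arithmetic of the minimum distances. -/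

/-- The minimum distance of the affine Reed-Muller code of degree `e` in `n` variables over a field
with `q` elements. -/
def rmWeight (q : ℕ) : ℕ → ℕ → ℕ
  | _, 0 => 1
  | e, n + 1 => if e < q - 1 then (q - e) * q ^ n else rmWeight q (e - (q - 1)) n

theorem rmWeight_pos {q : ℕ} (hq : 2 ≤ q) (e n : ℕ) : 0 < rmWeight q e n := by
  induction n generalizing e with
  | zero => simp [rmWeight]
  | succ n ih =>
    rw [rmWeight]
    split_ifs with h
    · exact Nat.mul_pos (by omega) (by positivity)
    · exact ih _

theorem rmWeight_add (q e n : ℕ) : rmWeight q (e + (q - 1)) (n + 1) = rmWeight q e n := by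
  rw [rmWeight, if_neg (by omega), Nat.add_sub_cancel]

theorem rmWeight_succ_of_le {q e n : ℕ} (hq : 2 ≤ q) (he : e ≤ q - 1) :
    rmWeight q e (n + 1) = (q - e) * q ^ n := by
  rcases he.lt_or_eq with h | h
  · rw [rmWeight, if_pos h]
  · subst h
    rw [rmWeight, if_neg (lt_irrefl _), Nat.sub_self, show q - (q - 1) = 1 by omega, one_mul]
    cases n with
    | zero => simp [rmWeight]
    | succ n => rw [rmWeight, if_pos (by omega), Nat.sub_zero, pow_succ']

/-- The boundary value `μ = q - 1` is allowed so that the formula also applies to degree `d + 1`,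
where the remainder of `d` is raised by one. -/
theorem rmWeight_eq {q μ : ℕ} (hq : 2 ≤ q) (hμ : μ ≤ q - 1) (ν k : ℕ) :
    rmWeight q (ν * (q - 1) + μ) (ν + 1 + k) = (q - μ) * q ^ k := by
  induction ν with
  | zero => rw [Nat.zero_mul, Nat.zero_add, Nat.zero_add, Nat.add_comm 1 k,
      rmWeight_succ_of_le hq hμ]
  | succ ν ih =>
    rw [show (ν + 1) * (q - 1) + μ = (ν * (q - 1) + μ) + (q - 1) by ring,
      show ν + 1 + 1 + k = (ν + 1 + k) + 1 by ring, rmWeight_add, ih]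

theorem rmWeight_eq_one {q e n : ℕ} (h : n * (q - 1) ≤ e) : rmWeight q e n = 1 := by
  induction n generalizing e with
  | zero => rfl
  | succ n ih =>
    rw [Nat.succ_mul] at h
    rw [rmWeight, if_neg (by omega), ih (by omega)]

/-- Induction step of the weight bound: `k` counts the vanishing slices. For `d < q - 1` it amounts
to `(q - k)(q - d + k) = q (q - d) + k (d - k)`. Otherwise `q - 1` is split off from `d`, leaving
`j`, and the case `k > j` reduces to `x + y - 1 ≤ x y` for `x, y ≥ 1`. -/
theorem rmWeight_succ_le_mul {q : ℕ} (hq : 2 ≤ q) {k d : ℕ} (n : ℕ) (hk : k ≤ q - 1)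
    (hkd : k ≤ d) : rmWeight q d (n + 1) ≤ (q - k) * rmWeight q (d - k) n := by
  induction n generalizing d with
  | zero =>
    rcases le_total d (q - 1) with h | h
    · rw [rmWeight_succ_of_le hq h]
      simp only [rmWeight, pow_zero, mul_one]
      omega
    · rw [rmWeight_eq_one (by omega)]
      simp only [rmWeight]
      omega
  | succ n ih =>
    rcases lt_or_ge d (q - 1) with h | h
    · rw [rmWeight_succ_of_le hq h.le, rmWeight_succ_of_le hq (by omega), pow_succ',
        ← mul_assoc, ← mul_assoc]
      refine Nat.mul_le_mul_right _ ?_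
      obtain ⟨a, rfl⟩ := Nat.exists_eq_add_of_le hkd
      rw [show k + a - k = a by omega]
      obtain ⟨c, hc⟩ : ∃ c, q = k + a + c := Nat.exists_eq_add_of_le (by omega)
      rw [show q - (k + a) = c by omega, show q - k = a + c by omega,
        show q - a = k + c by omega, hc]
      nlinarith
    · obtain ⟨j, rfl⟩ := Nat.exists_eq_add_of_le' h
      rw [rmWeight_add]
      rcases le_or_gt k j with hkj | hkj
      · rw [show j + (q - 1) - k = (j - k) + (q - 1) by omega, rmWeight_add]
        exact ih hkj
      · rw [rmWeight_succ_of_le hq (by omega : j ≤ q - 1), rmWeight_succ_of_le hq (by omega),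
          ← mul_assoc]
        refine Nat.mul_le_mul_right _ ?_
        obtain ⟨b, rfl⟩ := Nat.exists_eq_add_of_lt hkj
        obtain ⟨a, ha⟩ : ∃ a, q = (j + b + 1) + 1 + a := Nat.exists_eq_add_of_le (by omega)
        rw [show q - (j + (q - 1) - (j + b + 1)) = b + 2 by omega,
          show q - (j + b + 1) = a + 1 by omega, show q - j = a + b + 2 by omega]
        nlinarith

/-- This is what makes the decoder reach full capability: it compares the distance of
`PRM_{d+1}(m+1)` with those of `RM_{d+1}(m+1)` and `PRM_{d+1}(m)`. For remainder `0` and `ν < m` it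
is an equality. The alternative `m * (q - 1) ≤ d`, rather than an equality of quotients, survives
lowering `m` at fixed `d`. -/
theorem rmWeight_le_add {q : ℕ} (hq : 2 ≤ q) (d m : ℕ)
    (h : d % (q - 1) = 0 ∨ m * (q - 1) ≤ d) :
    rmWeight q d (m + 1) ≤ rmWeight q (d + 1) (m + 1) + rmWeight q d m := by
  have hdm := Nat.div_add_mod' d (q - 1)
  have hμ := Nat.mod_lt d (show 0 < q - 1 by omega)
  generalize d / (q - 1) = ν at *
  generalize d % (q - 1) = μ at *
  subst hdm
  rcases lt_trichotomy ν m with hν | rfl | hν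
  · have hμ0 : μ = 0 := by
      refine h.resolve_right fun h => ?_
      have : (ν + 1) * (q - 1) ≤ m * (q - 1) := Nat.mul_le_mul_right _ hν
      rw [Nat.succ_mul] at this
      omega
    obtain ⟨k, rfl⟩ := Nat.exists_eq_add_of_lt hν
    have h1 := rmWeight_eq hq hμ.le ν (k + 1)
    have h2 := rmWeight_eq hq (show μ + 1 ≤ q - 1 by omega) ν (k + 1)
    have h3 := rmWeight_eq hq hμ.le ν k
    rw [show ν + k + 1 + 1 = ν + 1 + (k + 1) by ring, show ν + k + 1 = ν + 1 + k by ring,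
      add_assoc _ μ 1, h1, h2, h3, hμ0]
    obtain ⟨r, rfl⟩ := Nat.exists_eq_add_of_le' (show 1 ≤ q by omega)
    simp only [zero_add, Nat.add_sub_cancel, Nat.sub_zero]
    exact le_of_eq (by ring)
  · have h1 := rmWeight_eq hq hμ.le ν 0
    have h2 := rmWeight_eq hq (show μ + 1 ≤ q - 1 by omega) ν 0
    have h3 := rmWeight_pos hq (ν * (q - 1) + μ) ν
    rw [add_assoc _ μ 1]
    simp only [add_zero, pow_zero, mul_one] at h1 h2
    omega
  · have : (m + 1) * (q - 1) ≤ ν * (q - 1) := Nat.mul_le_mul_right _ hν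
    rw [rmWeight_eq_one (by omega)]
    have := rmWeight_pos hq (ν * (q - 1) + μ + 1) (m + 1)
    omega

/-! ### Affine Reed–Muller codes and their minimum distance. -/

section RM

variable {F : Type*} [Field F]

theorem mem_RM {d n : ℕ} {c : AffWord F n} :
    c ∈ RM F d n ↔ ∃ f : MvPolynomial (Fin n) F, f.totalDegree ≤ d ∧ ∀ x, eval x f = c x := by
  simp only [RM, Submodule.mem_map, mem_restrictTotalDegree]
  exact exists_congr fun f => and_congr_right fun _ => funext_iff

theorem RM_mono {d e n : ℕ} (h : d ≤ e) : RM F d n ≤ RM F e n := by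
  intro c hc
  obtain ⟨f, hf, hfc⟩ := mem_RM.1 hc
  exact mem_RM.2 ⟨f, hf.trans h, hfc⟩

theorem const_mem_RM (n : ℕ) (a : F) : (fun _ => a) ∈ RM F 0 n :=
  mem_RM.2 ⟨C a, by simp, by simp⟩

theorem coord_mem_RM {n : ℕ} (i : Fin n) : (fun x => x i) ∈ RM F 1 n :=
  mem_RM.2 ⟨X i, by simp, by simp⟩

theorem mul_mem_RM {d e n : ℕ} {b c : AffWord F n} (hb : b ∈ RM F d n) (hc : c ∈ RM F e n) :
    b * c ∈ RM F (d + e) n := by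
  obtain ⟨f, hf, hfb⟩ := mem_RM.1 hb
  obtain ⟨g, hg, hgc⟩ := mem_RM.1 hc
  exact mem_RM.2 ⟨f * g, (totalDegree_mul f g).trans (by omega), fun x => by simp [hfb, hgc]⟩

theorem prod_mem_RM {ι : Type*} {n : ℕ} (s : Finset ι) (d : ι → ℕ) (c : ι → AffWord F n)
    (h : ∀ i ∈ s, c i ∈ RM F (d i) n) : ∏ i ∈ s, c i ∈ RM F (∑ i ∈ s, d i) n := by
  classical
  induction s using Finset.induction_on with
  | empty => exact const_mem_RM n (1 : F)
  | insert a s ha ih =>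
    rw [Finset.prod_insert ha, Finset.sum_insert ha]
    exact mul_mem_RM (h a (by simp)) (ih fun i hi => h i (by simp [hi]))

theorem pow_mem_RM {d n : ℕ} {c : AffWord F n} (hc : c ∈ RM F d n) (k : ℕ) :
    c ^ k ∈ RM F (k * d) n := by
  simpa using prod_mem_RM (Finset.range k) (fun _ => d) (fun _ => c) fun _ _ => hc

theorem prod_pow_mem_RM {k n : ℕ} (φ : Fin k → AffWord F n) (hφ : ∀ i, φ i ∈ RM F 1 n)
    (α : Fin k → ℕ) : ∏ i, φ i ^ α i ∈ RM F (∑ i, α i) n := by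
  simpa using prod_mem_RM Finset.univ (fun i => α i * 1) (fun i => φ i ^ α i)
    fun i _ => pow_mem_RM (hφ i) _

theorem comp_mem_RM {d k n : ℕ} {c : AffWord F k} (hc : c ∈ RM F d k)
    (φ : (Fin n → F) → (Fin k → F)) (hφ : ∀ i, (fun x => φ x i) ∈ RM F 1 n) :
    (fun x => c (φ x)) ∈ RM F d n := by
  obtain ⟨f, hf, hfc⟩ := mem_RM.1 hc
  have : (fun x => c (φ x)) =
      ∑ α ∈ f.support, f.coeff α • ∏ i, (fun x => φ x i : AffWord F n) ^ α i := by
    funext x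
    rw [← hfc, eval_eq']
    simp [Finset.sum_apply, Finset.prod_apply]
  rw [this]
  refine Submodule.sum_mem _ fun α hα => Submodule.smul_mem _ _ ?_
  refine RM_mono ?_ (prod_pow_mem_RM _ hφ α)
  refine le_trans ?_ ((le_totalDegree hα).trans hf)
  rw [Finsupp.sum_fintype _ _ fun _ => rfl]

theorem slice_mem_RM {d n : ℕ} {c : AffWord F (n + 1)} (hc : c ∈ RM F d (n + 1)) (a : F) :
    (fun x => c (Fin.cons a x)) ∈ RM F d n := by
  refine comp_mem_RM hc _ fun i => ?_
  refine Fin.cases ?_ (fun j => ?_) i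
  · simpa using RM_mono zero_le_one (const_mem_RM n a)
  · simpa using coord_mem_RM j

theorem tail_mem_RM {d n : ℕ} {c : AffWord F n} (hc : c ∈ RM F d n) :
    (fun x : Fin (n + 1) → F => c (Fin.tail x)) ∈ RM F d (n + 1) :=
  comp_mem_RM hc _ fun i => coord_mem_RM i.succ

/-- The difference of a word and its slice at `x_0 = a` is divisible by `x_0 - a`. -/
theorem exists_sub_slice_eq_mul {d n : ℕ} {c : AffWord F (n + 1)}
    (hc : c ∈ RM F (d + 1) (n + 1)) (a : F) :
    ∃ g ∈ RM F d (n + 1), ∀ x, c x - c (Fin.cons a (Fin.tail x)) = (x 0 - a) * g x := by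
  obtain ⟨f, hf, hfc⟩ := mem_RM.1 hc
  -- The quotient is built monomial by monomial from `x ^ k - a ^ k = (x - a) ∑ x ^ i a ^ (k - 1 -
  -- i)`.
  let g : (Fin (n + 1) →₀ ℕ) → AffWord F (n + 1) := fun α =>
    ∑ i ∈ Finset.range (α 0), (f.coeff α * a ^ (α 0 - 1 - i)) •
      ((fun x => x 0 : AffWord F (n + 1)) ^ i * ∏ j, (fun x => x (Fin.succ j)) ^ α (Fin.succ j))
  refine ⟨∑ α ∈ f.support, g α, ?_, fun x => ?_⟩
  · refine Submodule.sum_mem _ fun α hα => Submodule.sum_mem _ fun i hi =>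
      Submodule.smul_mem _ _ ?_
    refine RM_mono ?_ (mul_mem_RM (pow_mem_RM (coord_mem_RM 0) i)
      (prod_pow_mem_RM _ (fun j => coord_mem_RM (Fin.succ j)) fun j => α (Fin.succ j)))
    have h := (le_totalDegree hα).trans hf
    rw [Finsupp.sum_fintype _ _ fun _ => rfl, Fin.sum_univ_succ] at h
    rw [Finset.mem_range] at hi
    omega
  · rw [← hfc, ← hfc, eval_eq', eval_eq', ← Finset.sum_sub_distrib, Finset.sum_apply,
      Finset.mul_sum]
    refine Finset.sum_congr rfl fun α _ => ?_
    simp only [g, Fin.prod_univ_succ, Fin.cons_zero, Fin.cons_succ, Fin.tail, Finset.sum_apply,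
      Pi.smul_apply, Pi.mul_apply, Pi.pow_apply, Finset.prod_apply, smul_eq_mul]
    have h := geom_sum₂_mul (x 0) a (α 0)
    rw [← mul_sub, ← sub_mul, ← h, Finset.mul_sum, Finset.sum_mul, Finset.sum_mul,
      Finset.mul_sum]
    exact Finset.sum_congr rfl fun i _ => by ring

theorem eq_const_of_mem_RM_zero {n : ℕ} {c : AffWord F n} (hc : c ∈ RM F 0 n) (x y : Fin n → F) :
    c x = c y := by
  obtain ⟨f, hf, hfc⟩ := mem_RM.1 hc
  rw [← hfc, ← hfc, totalDegree_eq_zero_iff_eq_C.1 (Nat.le_zero.1 hf), eval_C, eval_C]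

/-- A nonzero word which vanishes on the hyperplanes `x_0 = a` for `a ∈ K` is divisible by the
product of the `x_0 - a`. -/
theorem exists_eq_prod_mul {d n : ℕ} {c : AffWord F (n + 1)} (hc : c ∈ RM F d (n + 1))
    (hc0 : c ≠ 0) (K : Finset F) (hK : ∀ a ∈ K, ∀ y, c (Fin.cons a y) = 0) :
    K.card ≤ d ∧ ∃ g ∈ RM F (d - K.card) (n + 1), ∀ x, c x = (∏ a ∈ K, (x 0 - a)) * g x := by
  classical
  induction K using Finset.induction_on with
  | empty => exact ⟨Nat.zero_le _, c, hc, by simp⟩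
  | insert b K hb ih =>
    obtain ⟨hKd, g, hg, hgc⟩ := ih fun a ha => hK a (by simp [ha])
    have hgb : ∀ y, g (Fin.cons b y) = 0 := by
      intro y
      have h := hK b (by simp) y
      rw [hgc, mul_eq_zero] at h
      refine h.resolve_left ?_
      refine Finset.prod_ne_zero_iff.2 fun a ha => ?_
      rw [Fin.cons_zero, sub_ne_zero]
      rintro rfl
      exact hb ha
    rw [Finset.card_insert_of_notMem hb]
    -- If the degree were already used up, the quotient would be a constant with a zero on `x_0 =
    -- b`, forcing `c = 0`.
    have hlt : K.card < d := by
      refine lt_of_le_of_ne hKd fun h => hc0 ?_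
      rw [h, Nat.sub_self] at hg
      funext x
      rw [hgc, eq_const_of_mem_RM_zero hg x (Fin.cons b (Fin.tail x)), hgb]
      simp
    refine ⟨hlt, ?_⟩
    rw [show d - K.card = d - (K.card + 1) + 1 by omega] at hg
    obtain ⟨g', hg', h⟩ := exists_sub_slice_eq_mul hg b
    refine ⟨g', hg', fun x => ?_⟩
    rw [Finset.prod_insert hb, hgc, mul_right_comm, mul_comm, ← h, hgb, sub_zero, mul_comm]

theorem two_le_card [Fintype F] : 2 ≤ Fintype.card F := Fintype.one_lt_card

variable [DecidableEq F]

theorem minDist_eq_of_forall_le {ι : Type*} [Fintype ι] {C : Submodule F (ι → F)} {w : ℕ}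
    (hw : 0 < w) (hle : ∀ c ∈ C, c ≠ 0 → w ≤ hammingNorm c) (h : ∃ c ∈ C, hammingNorm c = w) :
    minDist C = w := by
  obtain ⟨c, hc, hcw⟩ := h
  have hmem : w ∈ {w : ℕ | ∃ c ∈ C, c ≠ 0 ∧ hammingNorm c = w} :=
    ⟨c, hc, hammingNorm_pos_iff.1 (hcw ▸ hw), hcw⟩
  refine le_antisymm (Nat.sInf_le hmem) (le_csInf ⟨w, hmem⟩ ?_)
  rintro _ ⟨c, hc, hc0, rfl⟩
  exact hle c hc hc0

variable [Fintype F]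

theorem hammingNorm_eq_sum_slices {n : ℕ} (c : AffWord F (n + 1)) :
    hammingNorm c = ∑ a, hammingNorm fun y => c (Fin.cons a y) := by
  simp only [hammingNorm, Finset.card_filter]
  rw [← (Fin.consEquiv fun _ => F).sum_comp, Fintype.sum_prod_type]
  rfl

/-- Let `K` be the set of `a` whose slice vanishes. After division by the `x_0 - a` with `a ∈ K`,
each of the `q - |K|` other slices is a nonzero word of degree at most `d - |K|`, so induction
applies to it. -/
theorem rmWeight_le_hammingNorm {d n : ℕ} {c : AffWord F n} (hc : c ∈ RM F d n) (hc0 : c ≠ 0) :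
    rmWeight (Fintype.card F) d n ≤ hammingNorm c := by
  induction n generalizing d with
  | zero => exact hammingNorm_pos_iff.2 hc0
  | succ n ih =>
    classical
    let K : Finset F := {a | ∀ y, c (Fin.cons a y) = 0}
    obtain ⟨hKd, g, hg, hgc⟩ := exists_eq_prod_mul hc hc0 K fun a ha => by simpa [K] using ha
    have hK : K.card ≤ Fintype.card F - 1 := by
      refine Nat.le_sub_one_of_lt ((Finset.card_lt_iff_ne_univ K).2 fun h => hc0 ?_)
      funext x
      have : x 0 ∈ K := by simp [h]
      rw [← Fin.cons_self_tail x]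
      exact (Finset.mem_filter.1 this).2 _
    have hslice : ∀ a ∈ Kᶜ, rmWeight (Fintype.card F) (d - K.card) n ≤
        hammingNorm fun y => c (Fin.cons a y) := by
      intro a ha
      refine ih ?_ fun h => ?_
      · have : (fun y => c (Fin.cons a y)) =
            (∏ b ∈ K, (a - b)) • fun y : Fin n → F => g (Fin.cons a y) := by
          funext y
          simp [hgc]
        rw [this]
        exact Submodule.smul_mem _ _ (slice_mem_RM hg a)
      · exact Finset.mem_compl.1 ha (Finset.mem_filter.2 ⟨Finset.mem_univ _, congrFun h⟩)
    calc rmWeight (Fintype.card F) d (n + 1)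
        ≤ (Fintype.card F - K.card) * rmWeight (Fintype.card F) (d - K.card) n :=
          rmWeight_succ_le_mul two_le_card n hK hKd
      _ = ∑ a ∈ Kᶜ, rmWeight (Fintype.card F) (d - K.card) n := by
          rw [Finset.sum_const, Finset.card_compl, smul_eq_mul]
      _ ≤ ∑ a ∈ Kᶜ, hammingNorm fun y => c (Fin.cons a y) := Finset.sum_le_sum hslice
      _ ≤ hammingNorm c := by
          rw [hammingNorm_eq_sum_slices]
          exact Finset.sum_le_univ_sum_of_nonneg fun _ => Nat.zero_le _

/-- For `d < q - 1` take a product of `d` distinct factors `x_0 - b`. Otherwise multiply the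
indicator `1 - x_0 ^ (q - 1)` of `x_0 = 0` by an extremal word in the other variables. -/
theorem exists_mem_RM_hammingNorm_eq (F : Type*) [Field F] [Fintype F] [DecidableEq F]
    (d n : ℕ) : ∃ c ∈ RM F d n, hammingNorm c = rmWeight (Fintype.card F) d n := by
  induction n generalizing d with
  | zero =>
    exact ⟨fun _ => 1, RM_mono (Nat.zero_le d) (const_mem_RM 0 1), by
      simp [hammingNorm, rmWeight]⟩
  | succ n ih =>
    rw [rmWeight]
    split_ifs with hd
    · obtain ⟨B, -, hB⟩ := Finset.exists_subset_card_eq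
        (show d ≤ (Finset.univ : Finset F).card by rw [Finset.card_univ]; omega)
      refine ⟨∏ b ∈ B, ((fun x => x 0) - fun _ => b), ?_, ?_⟩
      · have := prod_mem_RM B (fun _ => 1)
          (fun b => ((fun x => x 0) - fun _ => b : AffWord F (n + 1))) fun b _ =>
          Submodule.sub_mem _ (coord_mem_RM 0) (RM_mono zero_le_one (const_mem_RM _ b))
        simpa [hB] using this
      · rw [hammingNorm_eq_sum_slices]
        have : ∀ a : F, (hammingNorm fun y : Fin n → F =>
            (∏ b ∈ B, ((fun x => x 0) - fun _ => b : AffWord F (n + 1)) :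
              AffWord F (n + 1)) (Fin.cons a y)) =
            if a ∈ Bᶜ then Fintype.card F ^ n else 0 := by
          intro a
          by_cases ha : a ∈ B
          · simp [hammingNorm, Finset.prod_apply, Finset.prod_eq_zero_iff, sub_eq_zero, ha]
          · simp [hammingNorm, Finset.prod_apply, Finset.prod_eq_zero_iff, sub_eq_zero, ha]
        simp only [this]
        rw [Finset.sum_ite_mem, Finset.univ_inter, Finset.sum_const, Finset.card_compl, hB,
          smul_eq_mul]
    · obtain ⟨c, hc, hcw⟩ := ih (d - (Fintype.card F - 1))
      refine ⟨((fun _ => 1) - (fun x => x 0) ^ (Fintype.card F - 1)) *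
        fun x => c (Fin.tail x), ?_, ?_⟩
      · refine RM_mono ?_ (mul_mem_RM (Submodule.sub_mem _ (RM_mono (Nat.zero_le _)
          (const_mem_RM _ 1)) (pow_mem_RM (coord_mem_RM 0) _)) (tail_mem_RM hc))
        omega
      · rw [hammingNorm_eq_sum_slices, Finset.sum_eq_single 0, ← hcw]
        · congr 1
          funext y
          have : Fintype.card F - 1 ≠ 0 := by have := two_le_card (F := F); omega
          simp [this]
        · intro a _ ha
          rw [hammingNorm_eq_zero]
          funext y
          simp [FiniteField.pow_card_sub_one_eq_one a ha]
        · simp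

theorem minDist_RM (F : Type*) [Field F] [Fintype F] [DecidableEq F] (d n : ℕ) :
    minDist (RM F d n) = rmWeight (Fintype.card F) d n :=
  minDist_eq_of_forall_le (rmWeight_pos two_le_card d n)
    (fun _ hc hc0 => rmWeight_le_hammingNorm hc hc0) (exists_mem_RM_hammingNorm_eq F d n)

end RM

/-! ### Splitting words into an affine part and a part at infinity. -/

section Words

variable {F : Type*} [Field F] [DecidableEq F] {m : ℕ}

theorem fstPart_glue (a : AffWord F (m + 1)) (b : ProjWord F m) : fstPart (glue a b) = a := by
  funext Q
  simp [fstPart, glue]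

theorem sndPart_glue (a : AffWord F (m + 1)) (b : ProjWord F m) : sndPart (glue a b) = b := by
  funext P
  simp [sndPart, glue]

theorem glue_parts (r : ProjWord F (m + 1)) : glue (fstPart r) (sndPart r) = r := by
  funext ⟨x, hx⟩
  by_cases h : x 0 = 0
  · have : (Fin.cons 0 (Fin.tail x) : Fin (m + 1 + 1) → F) = x := by
      rw [← h, Fin.cons_self_tail]
    simp [glue, sndPart, h, this]
  · have h1 : x 0 = 1 := by simpa [lead, h] using hx
    have : (Fin.cons 1 (Fin.tail x) : Fin (m + 1 + 1) → F) = x := by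
      rw [← h1, Fin.cons_self_tail]
    simp [glue, fstPart, h, this]

theorem eq_glue_iff {r : ProjWord F (m + 1)} {a : AffWord F (m + 1)} {b : ProjWord F m} :
    r = glue a b ↔ fstPart r = a ∧ sndPart r = b := by
  constructor
  · rintro rfl
    exact ⟨fstPart_glue a b, sndPart_glue a b⟩
  · rintro ⟨rfl, rfl⟩
    exact (glue_parts r).symm

theorem hammingNorm_eq_parts [Fintype F] (r : ProjWord F (m + 1)) :
    hammingNorm r = hammingNorm (fstPart r) + hammingNorm (sndPart r) := by
  let φ : (Fin (m + 1) → F) ⊕ ProjPt F m → ProjPt F (m + 1) :=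
    Sum.elim (fun Q => ⟨Fin.cons 1 Q, by simp [lead_cons]⟩)
      (fun P => ⟨Fin.cons 0 P.1, by simp [lead_cons, P.2]⟩)
  have hφ : Function.Bijective φ := by
    constructor
    · rintro (Q | P) (Q' | P') h
      · simpa [φ] using h
      · simpa [φ] using congrFun (congrArg Subtype.val h) 0
      · simpa [φ] using congrFun (congrArg Subtype.val h) 0
      · simpa [φ, Subtype.ext_iff] using h
    · rintro ⟨x, hx⟩
      by_cases h : x 0 = 0
      · refine ⟨Sum.inr ⟨Fin.tail x, by simpa [lead, h] using hx⟩, Subtype.ext ?_⟩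
        simp only [φ, Sum.elim_inr]
        rw [← h, Fin.cons_self_tail]
      · have h1 : x 0 = 1 := by simpa [lead, h] using hx
        refine ⟨Sum.inl (Fin.tail x), Subtype.ext ?_⟩
        simp only [φ, Sum.elim_inl]
        rw [← h1, Fin.cons_self_tail]
  simp only [hammingNorm, Finset.card_filter]
  rw [← hφ.sum_comp, Fintype.sum_sum_type]
  rfl

end Words

/-! ### Homogeneous polynomials, homogenization and linear changes of coordinates. -/

section Homogeneous

variable {F : Type*} [Field F] {n d : ℕ}

theorem degree_eq_univ_sum (α : Fin n →₀ ℕ) : α.degree = ∑ i, α i :=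
  Finsupp.degree_eq_sum α

theorem degree_le_totalDegree {f : MvPolynomial (Fin n) F} {α : Fin n →₀ ℕ}
    (hα : α ∈ f.support) : α.degree ≤ f.totalDegree :=
  le_totalDegree hα

theorem degree_eq_of_mem_support {f : MvPolynomial (Fin n) F} (hf : f.IsHomogeneous d)
    {α : Fin n →₀ ℕ} (hα : α ∈ f.support) : α.degree = d := by
  by_contra h
  exact mem_support_iff.1 hα (hf.coeff_eq_zero h)

theorem eval_smul_of_isHomogeneous {f : MvPolynomial (Fin n) F} (hf : f.IsHomogeneous d)
    (a : F) (x : Fin n → F) : eval (a • x) f = a ^ d * eval x f := by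
  rw [eval_eq', eval_eq', Finset.mul_sum]
  refine Finset.sum_congr rfl fun α hα => ?_
  simp only [Pi.smul_apply, smul_eq_mul, mul_pow, Finset.prod_mul_distrib]
  rw [Finset.prod_pow_eq_pow_sum, ← degree_eq_univ_sum, degree_eq_of_mem_support hf hα]
  ring

theorem eval_zero_of_isHomogeneous {f : MvPolynomial (Fin n) F} (hf : f.IsHomogeneous d)
    (hd : d ≠ 0) : eval 0 f = 0 := by
  have := eval_smul_of_isHomogeneous hf 0 0
  rwa [smul_zero, zero_pow hd, zero_mul] at this

/-- Substitution of linear forms; it serves both to move hyperplanes and to restrict to them. -/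
theorem exists_isHomogeneous_comp {k : ℕ} {f : MvPolynomial (Fin n) F} (hf : f.IsHomogeneous d)
    (L : (Fin k → F) →ₗ[F] (Fin n → F)) :
    ∃ g : MvPolynomial (Fin k) F, g.IsHomogeneous d ∧ ∀ y, eval y g = eval (L y) f := by
  refine ⟨aeval (fun i => ∑ j, C (L (Pi.single j 1) i) * X j) f, ?_, fun y => ?_⟩
  · have := hf.aeval (fun i => ∑ j, C (L (Pi.single j 1) i) * X j) (n := 1) fun i =>
      IsHomogeneous.sum _ _ _ fun j _ => isHomogeneous_C_mul_X _ _
    rwa [one_mul] at this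
  · have hL : ∀ i, L y i = ∑ j, L (Pi.single j 1) i * y j := by
      intro i
      conv_lhs => rw [← Finset.univ_sum_single y, map_sum, Finset.sum_apply]
      refine Finset.sum_congr rfl fun j _ => ?_
      rw [show (Pi.single j (y j) : Fin k → F) = y j • Pi.single j 1 by
        rw [← Pi.single_smul]; simp, map_smul, Pi.smul_apply, smul_eq_mul, mul_comm]
    rw [map_aeval]
    simp only [map_sum, map_mul, eval_C, eval_X]
    have : (eval y).comp (algebraMap F (MvPolynomial (Fin k) F)) = RingHom.id F := by
      ext a
      simp
    rw [this]
    simp only [← hL]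
    rfl

theorem exists_isHomogeneous_slice_zero {f : MvPolynomial (Fin (n + 1)) F}
    (hf : f.IsHomogeneous d) :
    ∃ g : MvPolynomial (Fin n) F, g.IsHomogeneous d ∧ ∀ y, eval y g = eval (Fin.cons 0 y) f :=
  exists_isHomogeneous_comp hf
    { toFun := fun y => Fin.cons 0 y
      map_add' := fun x y => by
        funext j
        refine Fin.cases ?_ (fun k => ?_) j <;> simp
      map_smul' := fun b x => by
        funext j
        refine Fin.cases ?_ (fun k => ?_) j <;> simp }

/-- The top degree terms cancel in `f(1, y) - f(0, y)`. -/
theorem sub_slices_mem_RM {f : MvPolynomial (Fin (n + 1)) F} (hf : f.IsHomogeneous (d + 1)) :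
    (fun y => eval (Fin.cons 1 y) f - eval (Fin.cons 0 y) f) ∈ RM F d n := by
  have : (fun y => eval (Fin.cons 1 y) f - eval (Fin.cons 0 y) f) =
      ∑ α ∈ f.support, (f.coeff α * (1 - 0 ^ α 0)) •
        ∏ j, (fun y => y j : AffWord F n) ^ α (Fin.succ j) := by
    funext y
    rw [eval_eq', eval_eq', ← Finset.sum_sub_distrib, Finset.sum_apply]
    refine Finset.sum_congr rfl fun α _ => ?_
    simp only [Fin.prod_univ_succ, Fin.cons_zero, Fin.cons_succ, Pi.smul_apply, Finset.prod_apply,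
      Pi.pow_apply, smul_eq_mul]
    ring
  rw [this]
  refine Submodule.sum_mem _ fun α hα => ?_
  -- A monomial without `x_0` has coefficient factor `1 - 0 ^ 0 = 0`; any other loses at least one
  -- degree when `x_0` is dropped.
  rcases Nat.eq_zero_or_pos (α 0) with h | h
  · simp [h]
  · refine Submodule.smul_mem _ _ (RM_mono ?_ (prod_pow_mem_RM _ coord_mem_RM _))
    have := degree_eq_of_mem_support hf hα
    rw [degree_eq_univ_sum, Fin.sum_univ_succ] at this
    omega

theorem isHomogeneous_homog {f : MvPolynomial (Fin n) F} (hf : f.totalDegree ≤ d) :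
    (homog d f).IsHomogeneous d := by
  refine IsHomogeneous.sum _ _ _ fun α hα => isHomogeneous_monomial _ ?_
  have := (degree_le_totalDegree hα).trans hf
  rw [degree_eq_univ_sum, Fin.sum_univ_succ]
  simp only [Finsupp.cons_zero, Finsupp.cons_succ]
  rw [← degree_eq_univ_sum]
  omega

theorem eval_homog (f : MvPolynomial (Fin n) F) (a : F) (y : Fin n → F) :
    eval (Fin.cons a y) (homog d f) =
      ∑ α ∈ f.support, a ^ (d - α.degree) * (f.coeff α * ∏ i, y i ^ α i) := by
  rw [homog, map_sum]
  refine Finset.sum_congr rfl fun α _ => ?_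
  rw [eval_monomial, Finsupp.prod_fintype _ _ fun _ => pow_zero _, Fin.prod_univ_succ]
  simp only [Fin.cons_zero, Fin.cons_succ, Finsupp.cons_zero, Finsupp.cons_succ]
  ring

theorem eval_homog_one (f : MvPolynomial (Fin n) F) (y : Fin n → F) :
    eval (Fin.cons 1 y) (homog d f) = eval y f := by
  simp [eval_homog, eval_eq' y f]

/-- Only terms with exponent `d - α.degree` equal to zero survive. The degree bound is needed
because truncated subtraction would also keep terms of degree above `d`. -/
theorem eval_homog_zero {f : MvPolynomial (Fin n) F} (hf : f.totalDegree ≤ d) (y : Fin n → F) :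
    eval (Fin.cons 0 y) (homog d f) = eval y (homogeneousComponent d f) := by
  rw [eval_homog, homogeneousComponent_apply, map_sum, Finset.sum_filter]
  refine Finset.sum_congr rfl fun α hα => ?_
  have := (degree_le_totalDegree hα).trans hf
  split_ifs with h
  · rw [h, Nat.sub_self, pow_zero, one_mul, eval_monomial,
      Finsupp.prod_fintype _ _ fun _ => pow_zero _]
  · rw [zero_pow (by omega), zero_mul]

/-- If `a i ≠ 0`, the form `a ⬝ᵥ x` together with the coordinates other than `x i` is a coordinate
system; the equivalence is the inverse of this map. -/
theorem exists_linearEquiv_dotProduct_eq {a : Fin (n + 1) → F} (ha : a ≠ 0) :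
    ∃ e : (Fin (n + 1) → F) ≃ₗ[F] (Fin (n + 1) → F), ∀ x, a ⬝ᵥ e x = x 0 := by
  obtain ⟨i, hi⟩ := Function.ne_iff.1 ha
  let φ : (Fin (n + 1) → F) →ₗ[F] (Fin (n + 1) → F) :=
    { toFun := fun x => Fin.cons (a ⬝ᵥ x) (i.removeNth x)
      map_add' := fun x y => by
        funext j
        refine Fin.cases ?_ (fun k => ?_) j <;> simp [Fin.removeNth_apply]
      map_smul' := fun b x => by
        funext j
        refine Fin.cases ?_ (fun k => ?_) j <;> simp [Fin.removeNth_apply] }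
  have hφ : Function.Injective φ := by
    rw [← LinearMap.ker_eq_bot, LinearMap.ker_eq_bot']
    intro x hx
    have h0 : a ⬝ᵥ x = 0 := by simpa [φ] using congrFun hx 0
    have hs : ∀ k, x (i.succAbove k) = 0 := fun k => by
      simpa [φ, Fin.removeNth_apply] using congrFun hx k.succ
    have hxi : x i = 0 := by
      rw [dotProduct, Fin.sum_univ_succAbove _ i] at h0
      simpa [hs, show a i ≠ 0 from hi] using h0
    funext j
    rcases Fin.eq_self_or_eq_succAbove i j with rfl | ⟨k, rfl⟩
    · exact hxi
    · exact hs k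
  refine ⟨(LinearEquiv.ofInjectiveEndo φ hφ).symm, fun x => ?_⟩
  exact congrFun (LinearEquiv.apply_symm_apply (LinearEquiv.ofInjectiveEndo φ hφ) x) 0

theorem mem_PRM [DecidableEq F] {c : ProjWord F n} :
    c ∈ PRM F d n ↔ ∃ f : MvPolynomial (Fin (n + 1)) F, f.IsHomogeneous d ∧ evP F n f = c := by
  simp only [PRM, Submodule.mem_map, mem_homogeneousSubmodule]

end Homogeneous

/-! ### Minimum distance of projective Reed–Muller codes. -/

section ProjectiveMinDist

variable {F : Type*} [Field F] [Fintype F] [DecidableEq F] {n d : ℕ}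

/-- Every projective point has `q - 1` representatives. -/
theorem hammingNorm_evA_of_isHomogeneous {f : MvPolynomial (Fin (n + 1)) F}
    (hf : f.IsHomogeneous (d + 1)) :
    hammingNorm (evA F (n + 1) f) = (Fintype.card F - 1) * hammingNorm (evP F n f) := by
  have h0 : ∀ x, eval x f ≠ 0 → x ≠ 0 := by
    rintro x hx rfl
    exact hx (eval_zero_of_isHomogeneous hf (Nat.succ_ne_zero d))
  have hcard : Fintype.card F - 1 = (Finset.univ.erase (0 : F)).card := by
    rw [Finset.card_erase_of_mem (Finset.mem_univ _), Finset.card_univ]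
  rw [hcard, hammingNorm, hammingNorm, ← Finset.card_product]
  symm
  refine Finset.card_bij (fun p _ => p.1 • p.2.1) ?_ ?_ ?_
  · rintro ⟨a, P⟩ h
    simp only [Finset.mem_product, Finset.mem_erase, Finset.mem_filter, Finset.mem_univ, and_true,
      true_and] at h ⊢
    change eval _ f ≠ 0
    rw [eval_smul_of_isHomogeneous hf]
    exact mul_ne_zero (pow_ne_zero _ h.1) h.2
  · rintro ⟨a, P⟩ h ⟨b, P'⟩ h' heq
    simp only [Finset.mem_product, Finset.mem_erase, Finset.mem_univ, and_true] at h h'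
    dsimp only at heq
    have hab : a = b := by simpa [lead_smul, P.2, P'.2] using congrArg lead heq
    subst hab
    rw [smul_right_inj h.1] at heq
    rw [Subtype.ext heq]
  · intro x hx
    have hx0 : eval x f ≠ 0 := (Finset.mem_filter.1 hx).2
    have hl := lead_ne_zero (h0 x hx0)
    refine ⟨(lead x, ⟨(lead x)⁻¹ • x, by rw [lead_smul, inv_mul_cancel₀ hl]⟩), ?_, ?_⟩
    · simp only [Finset.mem_product, Finset.mem_erase, Finset.mem_filter, Finset.mem_univ,
        and_true, true_and]
      refine ⟨hl, ?_⟩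
      change eval _ f ≠ 0
      rw [eval_smul_of_isHomogeneous hf]
      exact mul_ne_zero (pow_ne_zero _ (inv_ne_zero hl)) hx0
    · exact smul_inv_smul₀ hl x

/-- Parametrization of the points of the hyperplane `x_0 = 0`, transported by `e`. -/
theorem card_filter_dotProduct {a : Fin (n + 1) → F}
    (e : (Fin (n + 1) → F) ≃ₗ[F] (Fin (n + 1) → F)) (he : ∀ x, a ⬝ᵥ e x = x 0)
    (p : (Fin (n + 1) → F) → Prop) [DecidablePred p] :
    (Finset.univ.filter fun x => a ⬝ᵥ x = 0 ∧ p x).card =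
      (Finset.univ.filter fun y : Fin n → F => p (e (Fin.cons 0 y))).card := by
  symm
  refine Finset.card_bij (fun y _ => e (Fin.cons 0 y)) ?_ ?_ ?_
  · intro y hy
    simpa [he] using hy
  · intro y _ y' _ h
    simpa using h
  · intro x hx
    simp only [Finset.mem_filter, Finset.mem_univ, true_and] at hx
    have h0 : e.symm x 0 = 0 := by
      rw [← he (e.symm x), e.apply_symm_apply, hx.1]
    have : e (Fin.cons 0 (Fin.tail (e.symm x))) = x := by
      rw [← h0, Fin.cons_self_tail, e.apply_symm_apply]
    exact ⟨Fin.tail (e.symm x), by simpa [this] using hx.2, this⟩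

theorem card_hyperplane {a : Fin (n + 1) → F} (ha : a ≠ 0) :
    (Finset.univ.filter fun x => a ⬝ᵥ x = 0).card = Fintype.card F ^ n := by
  obtain ⟨e, he⟩ := exists_linearEquiv_dotProduct_eq ha
  have := card_filter_dotProduct e he fun _ => True
  simpa using this

/-- All the weight is on the affine part, and there `f(1, y) = f(1, y) - f(0, y)` has lost its top
degree. -/
theorem rmWeight_le_hammingNorm_of_vanish {f : MvPolynomial (Fin (n + 2)) F}
    (hf : f.IsHomogeneous (d + 1)) (hf0 : evP F (n + 1) f ≠ 0)
    (hv : ∀ y, eval (Fin.cons 0 y) f = 0) :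
    rmWeight (Fintype.card F) d (n + 1) ≤ hammingNorm (evP F (n + 1) f) := by
  have hs : sndPart (evP F (n + 1) f) = 0 := funext fun P => hv P.1
  rw [hammingNorm_eq_parts, hs, hammingNorm_zero, add_zero]
  refine rmWeight_le_hammingNorm ?_ fun h => hf0 ?_
  · have := sub_slices_mem_RM hf
    simp only [hv, sub_zero] at this
    exact this
  · rw [← glue_parts (evP F (n + 1) f), h, hs]
    funext x
    simp [glue]

/-- Either `f` vanishes on a hyperplane, which may be taken as `x_0 = 0`, or induction bounds the
weight on every hyperplane by `W = rmWeight q d n`. Counting incidences in the second case gives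
`(q^(n+2) - 1) W ≤ (q^(n+1) - 1) N` for the weight `N`, so `N ≥ q W`. -/
theorem rmWeight_le_hammingNorm_evP {f : MvPolynomial (Fin (n + 1)) F}
    (hf : f.IsHomogeneous (d + 1)) (hf0 : evP F n f ≠ 0) :
    rmWeight (Fintype.card F) d n ≤ hammingNorm (evP F n f) := by
  have hq := two_le_card (F := F)
  induction n with
  | zero => exact hammingNorm_pos_iff.2 hf0
  | succ n ih =>
    by_cases hv : ∃ a : Fin (n + 2) → F, a ≠ 0 ∧ ∀ x, a ⬝ᵥ x = 0 → eval x f = 0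
    · obtain ⟨a, ha, hav⟩ := hv
      obtain ⟨e, he⟩ := exists_linearEquiv_dotProduct_eq ha
      obtain ⟨g, hg, hge⟩ := exists_isHomogeneous_comp hf e.toLinearMap
      -- The map `e` need not preserve the standard representatives, so weights are compared on the
      -- whole vector space.
      have hN : hammingNorm (evA F (n + 2) g) = hammingNorm (evA F (n + 2) f) := by
        refine Finset.card_bij (fun x _ => e x) ?_ ?_ ?_
        · intro x hx
          have hx0 : eval x g ≠ 0 := (Finset.mem_filter.1 hx).2
          rw [hge] at hx0
          exact Finset.mem_filter.2 ⟨Finset.mem_univ _, hx0⟩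
        · exact fun x _ y _ h => e.injective h
        · intro x hx
          refine ⟨e.symm x, Finset.mem_filter.2 ⟨Finset.mem_univ _, ?_⟩, e.apply_symm_apply x⟩
          change eval _ g ≠ 0
          rw [hge, LinearEquiv.coe_coe, e.apply_symm_apply]
          exact (Finset.mem_filter.1 hx).2
      rw [hammingNorm_evA_of_isHomogeneous hg, hammingNorm_evA_of_isHomogeneous hf] at hN
      have hN' := Nat.eq_of_mul_eq_mul_left (by omega) hN
      rw [← hN']
      refine rmWeight_le_hammingNorm_of_vanish hg ?_ fun y => ?_
      · rw [← hammingNorm_pos_iff, hN', hammingNorm_pos_iff]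
        exact hf0
      · rw [hge]
        exact hav _ (by simp [he])
    · push Not at hv
      -- double counting of the pairs of a hyperplane and a point on it where `f` does not vanish
      have key : ∀ a ∈ Finset.univ.erase (0 : Fin (n + 2) → F),
          (Fintype.card F - 1) * rmWeight (Fintype.card F) d n ≤
            (Finset.univ.filter fun x => a ⬝ᵥ x = 0 ∧ eval x f ≠ 0).card := by
        intro a ha
        have ha0 := Finset.ne_of_mem_erase ha
        obtain ⟨e, he⟩ := exists_linearEquiv_dotProduct_eq ha0
        obtain ⟨g', hg', hge'⟩ := exists_isHomogeneous_comp hf e.toLinearMap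
        obtain ⟨g, hg, hge⟩ := exists_isHomogeneous_slice_zero hg'
        have hcard : (Finset.univ.filter fun x => a ⬝ᵥ x = 0 ∧ eval x f ≠ 0).card =
            hammingNorm (evA F (n + 1) g) := by
          rw [card_filter_dotProduct e he, hammingNorm]
          congr 1
          refine Finset.filter_congr fun y _ => ?_
          change _ ↔ eval y g ≠ 0
          rw [hge, hge']
          rfl
        rw [hcard, hammingNorm_evA_of_isHomogeneous hg]
        refine Nat.mul_le_mul_left _ (ih hg ?_)
        rw [← hammingNorm_pos_iff]
        refine Nat.pos_of_mul_pos_left (a := Fintype.card F - 1) ?_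
        rw [← hammingNorm_evA_of_isHomogeneous hg, ← hcard, Finset.card_pos]
        obtain ⟨x, hx, hx0⟩ := hv a ha0
        exact ⟨x, by simp [hx, hx0]⟩
      have hcount : ∑ a ∈ Finset.univ.erase (0 : Fin (n + 2) → F),
          (Finset.univ.filter fun x => a ⬝ᵥ x = 0 ∧ eval x f ≠ 0).card =
          hammingNorm (evA F (n + 2) f) * (Fintype.card F ^ (n + 1) - 1) := by
        have h0 : ∀ x ∈ Finset.univ.filter fun x => eval x f ≠ 0,
            ((Finset.univ.erase (0 : Fin (n + 2) → F)).filter fun a => a ⬝ᵥ x = 0).card =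
              Fintype.card F ^ (n + 1) - 1 := by
          intro x hx
          have hx0 : x ≠ 0 := by
            rintro rfl
            exact (Finset.mem_filter.1 hx).2 (eval_zero_of_isHomogeneous hf (Nat.succ_ne_zero d))
          rw [← card_hyperplane hx0, Finset.filter_erase, Finset.card_erase_of_mem (by simp)]
          simp only [dotProduct_comm]
        calc _ = ∑ a ∈ Finset.univ.erase (0 : Fin (n + 2) → F),
              ∑ x ∈ Finset.univ.filter fun x => eval x f ≠ 0, if a ⬝ᵥ x = 0 then 1 else 0 := by
              refine Finset.sum_congr rfl fun a _ => ?_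
              rw [← Finset.card_filter, Finset.filter_filter]
              simp only [and_comm]
          _ = ∑ x ∈ Finset.univ.filter fun x => eval x f ≠ 0,
              (Fintype.card F ^ (n + 1) - 1) := by
              rw [Finset.sum_comm]
              refine Finset.sum_congr rfl fun x hx => ?_
              rw [← Finset.card_filter, h0 x hx]
          _ = _ := by
              rw [Finset.sum_const, smul_eq_mul]
              rfl
      have hle := Finset.card_nsmul_le_sum _ _ _ key
      rw [hcount, Finset.card_erase_of_mem (Finset.mem_univ _), Finset.card_univ, Fintype.card_fun,
        Fintype.card_fin, smul_eq_mul, hammingNorm_evA_of_isHomogeneous hf] at hle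
      have hpow : 0 < Fintype.card F ^ (n + 1) - 1 := by
        have : 1 < Fintype.card F ^ (n + 1) := Nat.one_lt_pow (Nat.succ_ne_zero n) hq
        omega
      have hq1 : 0 < Fintype.card F - 1 := by omega
      -- The case `k = 0` is the inequality `rmWeight q d (n + 1) ≤ q * W`.
      have hW := rmWeight_succ_le_mul hq (k := 0) (d := d) n (Nat.zero_le _) (Nat.zero_le _)
      rw [Nat.sub_zero, Nat.sub_zero] at hW
      refine hW.trans ?_
      generalize rmWeight (Fintype.card F) d n = W at *
      generalize hammingNorm (evP F (n + 1) f) = N at *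
      have hstep : Fintype.card F * (Fintype.card F ^ (n + 1) - 1) ≤
          Fintype.card F ^ (n + 2) - 1 := by
        rw [Nat.mul_sub, ← pow_succ', mul_one]
        exact Nat.sub_le_sub_left (by omega) _
      refine Nat.le_of_mul_le_mul_left ?_ (Nat.mul_pos hq1 hpow)
      calc (Fintype.card F - 1) * (Fintype.card F ^ (n + 1) - 1) * (Fintype.card F * W)
          = Fintype.card F * (Fintype.card F ^ (n + 1) - 1) * ((Fintype.card F - 1) * W) := by
            ring
        _ ≤ (Fintype.card F ^ (n + 2) - 1) * ((Fintype.card F - 1) * W) :=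
            Nat.mul_le_mul_right _ hstep
        _ ≤ (Fintype.card F - 1) * N * (Fintype.card F ^ (n + 1) - 1) := hle
        _ = _ := by ring

/-- The bound is attained by homogenizing a minimum weight word of `RM_d(n)` to degree `d + 1`: the
extra degree makes it vanish at infinity. -/
theorem minDist_PRM (F : Type*) [Field F] [Fintype F] [DecidableEq F] (d n : ℕ) :
    minDist (PRM F (d + 1) n) = rmWeight (Fintype.card F) d n := by
  refine minDist_eq_of_forall_le (rmWeight_pos two_le_card d n) ?_ ?_
  · intro c hc hc0
    obtain ⟨f, hf, rfl⟩ := mem_PRM.1 hc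
    exact rmWeight_le_hammingNorm_evP hf hc0
  · obtain ⟨b, hb, hbw⟩ := exists_mem_RM_hammingNorm_eq F d n
    obtain ⟨g, hg, hgb⟩ := mem_RM.1 hb
    refine ⟨_, mem_PRM.2 ⟨_, isHomogeneous_homog (hg.trans (Nat.le_succ d)), rfl⟩, ?_⟩
    have h1 : ∀ y, eval (Fin.cons 1 y) (homog (d + 1) g) = b y := fun y => by
      rw [eval_homog_one, hgb]
    have h0 : ∀ y, eval (Fin.cons 0 y) (homog (d + 1) g) = 0 := fun y => by
      rw [eval_homog_zero (hg.trans (Nat.le_succ d)),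
        homogeneousComponent_eq_zero _ _ (Nat.lt_succ_of_le hg), map_zero]
    cases n with
    | zero =>
      let P : ProjPt F 0 := ⟨fun _ => 1, by simp [lead]⟩
      have huniq : ∀ x : ProjPt F 0, x = P := by
        rintro ⟨x, hx⟩
        refine Subtype.ext (funext fun i => ?_)
        rw [Fin.fin_one_eq_zero i]
        by_cases h : x 0 = 0
        · simp [lead, h] at hx
        · simpa [lead, h] using hx
      have hb0 : b ![] ≠ 0 := by
        intro h
        have : b = 0 := funext fun x => by rw [Subsingleton.elim x ![], h, Pi.zero_apply]
        rw [this, hammingNorm_zero] at hbw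
        exact (rmWeight_pos two_le_card d 0).ne hbw
      have hP : evP F 0 (homog (d + 1) g) P ≠ 0 := by
        rw [← h1] at hb0
        have hP1 : (Fin.cons 1 ![] : Fin 1 → F) = fun _ => 1 :=
          funext fun i => by rw [Fin.fin_one_eq_zero i]; rfl
        rwa [hP1] at hb0
      rw [rmWeight, hammingNorm, Finset.card_eq_one]
      refine ⟨P, Finset.eq_singleton_iff_unique_mem.2 ⟨by simpa using hP, fun x _ => huniq x⟩⟩
    | succ n =>
      rw [hammingNorm_eq_parts, ← hbw]
      have hs : sndPart (evP F (n + 1) (homog (d + 1) g)) = 0 := funext fun P => h0 P.1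
      rw [hs, hammingNorm_zero, add_zero]
      exact congrArg hammingNorm (funext h1)

end ProjectiveMinDist

/-! ### The polynomial operations of the decoder, and polynomials vanishing on affine space. -/

section PolynomialOperations

variable {F : Type*} [Field F] {n d : ℕ}

theorem totalDegree_lt_of_homogeneousComponent_eq_zero {f : MvPolynomial (Fin n) F} (hd : 0 < d)
    (hf : f.totalDegree ≤ d) (h : homogeneousComponent d f = 0) : f.totalDegree < d := by
  rw [totalDegree, Finset.sup_lt_iff hd]
  intro α hα
  refine lt_of_le_of_ne ((degree_le_totalDegree hα).trans hf) fun heq => ?_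
  have := coeff_homogeneousComponent d f α
  rw [h, if_pos (show α.degree = d from heq), coeff_zero] at this
  exact mem_support_iff.1 hα this.symm

theorem homogeneousComponent_mul_of_isHomogeneous {e : ℕ} (k : ℕ) (p : MvPolynomial (Fin n) F)
    {g : MvPolynomial (Fin n) F} (hg : g.IsHomogeneous e) :
    homogeneousComponent (k + e) (p * g) = homogeneousComponent k p * g := by
  conv_lhs => rw [← sum_homogeneousComponent p, Finset.sum_mul, map_sum]
  have : ∀ i, homogeneousComponent (k + e) (homogeneousComponent i p * g) =
      if k = i then homogeneousComponent i p * g else 0 := by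
    intro i
    rw [homogeneousComponent_of_mem ((homogeneousComponent_isHomogeneous i p).mul hg)]
    simp only [Nat.add_right_cancel_iff]
  simp only [this]
  rw [Finset.sum_ite_eq]
  split_ifs with h
  · rfl
  · rw [homogeneousComponent_eq_zero, zero_mul]
    simpa using h

theorem eval_cons_rename_succ {n : ℕ} (a : F) (y : Fin n → F) (p : MvPolynomial (Fin n) F) :
    eval (Fin.cons a y) (rename Fin.succ p) = eval y p := by
  rw [eval_rename]
  rfl

theorem exists_dehomogenization {f : MvPolynomial (Fin (n + 1)) F} (hf : f.IsHomogeneous d) :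
    ∃ g : MvPolynomial (Fin n) F, g.totalDegree ≤ d ∧
      (∀ y, eval y g = eval (Fin.cons 1 y) f) ∧
      ∀ y, eval y (homogeneousComponent d g) = eval (Fin.cons 0 y) f := by
  have hdeg : ∀ α ∈ f.support, α 0 + α.tail.degree = d := by
    intro α hα
    rw [← degree_eq_of_mem_support hf hα, degree_eq_univ_sum, degree_eq_univ_sum,
      Fin.sum_univ_succ]
    rfl
  refine ⟨∑ α ∈ f.support, monomial α.tail (f.coeff α), ?_, fun y => ?_, fun y => ?_⟩
  · refine totalDegree_finsetSum_le fun α hα => (totalDegree_monomial_le _ _).trans ?_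
    change α.tail.degree ≤ d
    have := hdeg α hα
    omega
  · rw [map_sum, eval_eq']
    refine Finset.sum_congr rfl fun α _ => ?_
    rw [eval_monomial, Finsupp.prod_fintype _ _ fun _ => pow_zero _, Fin.prod_univ_succ]
    simp [Finsupp.tail_apply]
  · rw [map_sum, map_sum, eval_eq']
    refine Finset.sum_congr rfl fun α hα => ?_
    have hα' := hdeg α hα
    rw [homogeneousComponent_of_mem (isHomogeneous_monomial _ rfl), Fin.prod_univ_succ]
    split_ifs with h
    · rw [eval_monomial, Finsupp.prod_fintype _ _ fun _ => pow_zero _,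
        show α 0 = 0 by omega]
      simp [Finsupp.tail_apply]
    · rw [Fin.cons_zero, zero_pow (by omega), map_zero, zero_mul, mul_zero]

theorem isHomogeneous_raise {e : ℕ} {f : MvPolynomial (Fin n) F} (hf : f.IsHomogeneous (e + 1))
    (hd : e + 1 ≤ d) : (raise d f).IsHomogeneous d := by
  refine IsHomogeneous.sum _ _ _ fun α hα => isHomogeneous_monomial _ ?_
  have hdeg := degree_eq_of_mem_support hf hα
  have hne : α.support.Nonempty := by
    rw [Finsupp.support_nonempty_iff]
    rintro rfl
    simp at hdeg
  rw [dif_pos hne, map_add, Finsupp.degree_single, hdeg]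
  omega

variable [Fintype F]

/-- Bad monomials have degree less than `d`, so removing them does not affect the top component. -/
theorem goodTop_eq (d : ℕ) (f : MvPolynomial (Fin n) F) :
    goodTop d f = homogeneousComponent d f := by
  rw [goodTop, map_sub, sub_eq_self, badPart, map_sum]
  refine Finset.sum_eq_zero fun α hα => ?_
  rw [homogeneousComponent_of_mem (isHomogeneous_monomial _ rfl), if_neg]
  exact (Finset.mem_filter.1 hα).2.2.1.ne'

theorem totalDegree_reduce_le (f : MvPolynomial (Fin n) F) :
    (reduce f).totalDegree ≤ f.totalDegree := by
  refine totalDegree_finsetSum_le fun α hα => (totalDegree_monomial_le _ _).trans ?_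
  refine le_trans ?_ (degree_le_totalDegree hα)
  rw [Finsupp.sum_fintype _ _ fun _ => rfl, degree_eq_univ_sum]
  refine Finset.sum_le_sum fun i _ => ?_
  rw [Finsupp.mapRange_apply]
  split_ifs with h
  · exact Nat.zero_le _
  · have := Nat.mod_le (α i - 1) (Fintype.card F - 1)
    simp only [id_eq]
    omega

theorem eval_reduce (f : MvPolynomial (Fin n) F) (y : Fin n → F) :
    eval y (reduce f) = eval y f := by
  rw [reduce, map_sum, eval_eq' y f]
  refine Finset.sum_congr rfl fun α _ => ?_
  rw [eval_monomial, Finsupp.prod_fintype _ _ fun _ => pow_zero _]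
  congr 1
  refine Finset.prod_congr rfl fun i _ => ?_
  rw [Finsupp.mapRange_apply]
  split_ifs with h
  · rw [h]
  · by_cases hy : y i = 0
    · rw [hy, zero_pow (Nat.succ_ne_zero _), zero_pow h]
    · obtain ⟨a, ha⟩ := Nat.exists_eq_succ_of_ne_zero h
      rw [ha, Nat.succ_sub_one]
      conv_rhs => rw [Nat.succ_eq_add_one, ← Nat.div_add_mod a (Fintype.card F - 1)]
      rw [add_assoc, pow_add _ (_ * _), pow_mul, FiniteField.pow_card_sub_one_eq_one _ hy, one_pow,
        one_mul]

/-- The added factor is `x_i ^ (q - 1)` for a variable already dividing the monomial: it is `1`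
where `x_i ≠ 0`, and both sides vanish elsewhere. -/
theorem eval_raise {f : MvPolynomial (Fin n) F} (hf : f.IsHomogeneous d) (y : Fin n → F) :
    eval y (raise (d + (Fintype.card F - 1)) f) = eval y f := by
  rw [raise, map_sum]
  conv_rhs => rw [f.as_sum, map_sum]
  refine Finset.sum_congr rfl fun α hα => ?_
  rw [degree_eq_of_mem_support hf hα, Nat.add_sub_cancel_left]
  split_ifs with h
  · rw [monomial_add_single, map_mul, map_pow, eval_X]
    set i := α.support.min' h
    by_cases hy : y i = 0
    · have hi : α i ≠ 0 := Finsupp.mem_support_iff.1 (Finset.min'_mem _ h)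
      have : eval y (monomial α (coeff α f)) = 0 := by
        rw [eval_monomial, Finsupp.prod_fintype _ _ fun _ => pow_zero _,
          Finset.prod_eq_zero (Finset.mem_univ i) (by rw [hy, zero_pow hi]), mul_zero]
      rw [this, zero_mul]
    · rw [FiniteField.pow_card_sub_one_eq_one _ hy, mul_one]
  · rfl

theorem eq_zero_of_totalDegree_lt_card {h : MvPolynomial (Fin n) F}
    (hdeg : h.totalDegree < Fintype.card F) (h0 : ∀ y, eval y h = 0) : h = 0 :=
  eq_zero_of_eval_zero_at_prod_finset h (fun _ => Finset.univ)
    (fun i => (degreeOf_le_totalDegree h i).trans_lt (by simpa using hdeg)) fun y _ => h0 y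

theorem prod_X_sub_C_eq (F : Type*) [Field F] [Fintype F] :
    ∏ s : F, (Polynomial.X - Polynomial.C s) = Polynomial.X ^ Fintype.card F - Polynomial.X := by
  have hq := two_le_card (F := F)
  have hroots := FiniteField.roots_X_pow_card_sub_X F
  have := Polynomial.prod_multiset_X_sub_C_of_monic_of_roots_card_eq
    (p := (Polynomial.X ^ Fintype.card F - Polynomial.X : Polynomial F))
    (Polynomial.monic_X_pow_sub (by rw [Polynomial.degree_X]; exact_mod_cast hq)) (by
      rw [hroots, FiniteField.X_pow_card_sub_X_natDegree_eq F hq]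
      rfl)
  rwa [hroots] at this

/-- The top component of a polynomial vanishing on `F ^ n` coincides as a function with a
homogeneous polynomial whose degree is smaller by `q - 1`. -/
theorem exists_isHomogeneous_eval_homogeneousComponent {h : MvPolynomial (Fin n) F}
    (hdeg : h.totalDegree ≤ d + Fintype.card F) (h0 : ∀ y, eval y h = 0) :
    ∃ b : MvPolynomial (Fin n) F, b.IsHomogeneous (d + 1) ∧
      ∀ y, eval y b = eval y (homogeneousComponent (d + Fintype.card F) h) := by
  have hq := two_le_card (F := F)
  -- The Nullstellensatz writes `h = ∑ H_i (x_i ^ q - x_i)` without raising degrees, hence `deg H_i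
  -- ≤ d`.
  obtain ⟨H, hH, hsum⟩ := combinatorial_nullstellensatz_exists_linearCombination
    (fun _ : Fin n => (Finset.univ : Finset F)) (fun _ => Finset.univ_nonempty) h fun y _ => h0 y
  have hprod : ∀ i : Fin n, ∏ s : F, (X i - C s : MvPolynomial (Fin n) F) =
      X i ^ Fintype.card F - X i := by
    intro i
    have := congrArg (Polynomial.aeval (X i : MvPolynomial (Fin n) F))
      (prod_X_sub_C_eq F)
    simpa [map_prod, algebraMap_eq] using this
  simp only [hprod] at hH hsum
  have hHdeg : ∀ i, (H i).totalDegree ≤ d := by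
    intro i
    by_cases hi : H i = 0
    · simp [hi]
    · have hX : (X i ^ Fintype.card F - X i : MvPolynomial (Fin n) F).totalDegree =
          Fintype.card F := by
        rw [sub_eq_add_neg, totalDegree_add_eq_left_of_totalDegree_lt, totalDegree_X_pow]
        rw [totalDegree_neg, totalDegree_X_pow, totalDegree_X]
        omega
      have hX0 : (X i ^ Fintype.card F - X i : MvPolynomial (Fin n) F) ≠ 0 := by
        intro h
        rw [h, totalDegree_zero] at hX
        omega
      have := (hH i).trans hdeg
      rw [totalDegree_mul_of_isDomain hX0 hi, hX] at this
      omega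
  -- The top component of `h` is the sum of the `(H_i)_d x_i ^ q`, and `x_i ^ q = x_i` as functions.
  refine ⟨∑ i, homogeneousComponent d (H i) * X i,
    IsHomogeneous.sum _ _ _ fun i _ =>
      (homogeneousComponent_isHomogeneous d (H i)).mul (isHomogeneous_X F i), fun y => ?_⟩
  rw [hsum, Finsupp.linearCombination_apply, Finsupp.sum_fintype _ _ (by simp),
    map_sum, map_sum, map_sum]
  refine Finset.sum_congr rfl fun i _ => ?_
  have hlow : homogeneousComponent (d + Fintype.card F) (H i * X i) = 0 := by
    refine homogeneousComponent_eq_zero _ _ ((totalDegree_mul _ _).trans_lt ?_)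
    rw [totalDegree_X]
    have := hHdeg i
    omega
  rw [smul_eq_mul, mul_sub, map_sub, hlow, sub_zero,
    homogeneousComponent_mul_of_isHomogeneous d (H i) (isHomogeneous_X_pow i _), map_mul, map_mul,
    map_pow, eval_X, FiniteField.pow_card]

end PolynomialOperations

/-! ### Soundness and correctness of the decoder. -/

section Decoder

variable {F : Type*} [Field F] [DecidableEq F] {m d : ℕ}

/-- Whatever the decoder returns is a codeword of `PRM_d(m)` with a polynomial representing it. -/
def IsSound (d : ℕ) (P : ProjDecoder F m) : Prop :=
  ∀ r c f, P r = some (c, f) → f.IsHomogeneous d ∧ evP F m f = c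

theorem direct_isSound (m d : ℕ) : IsSound d (direct m d : ProjDecoder F m) := by
  intro r c f h
  rw [direct] at h
  split_ifs at h with hex
  simp only [Option.some.injEq, Prod.mk.injEq] at h
  obtain ⟨rfl, rfl⟩ := h
  exact hex.choose_spec

theorem direct_eq_some {c : ProjWord F m} (hc : c ∈ PRM F d m) :
    ∃ f, direct m d c = some (c, f) :=
  ⟨_, dif_pos (mem_PRM.1 hc)⟩

theorem evP_eq_glue {f : MvPolynomial (Fin (m + 2)) F} {a : AffWord F (m + 1)} {b : ProjWord F m}
    (ha : ∀ y, eval (Fin.cons 1 y) f = a y) (hb : ∀ P : ProjPt F m, eval (Fin.cons 0 P.1) f = b P) :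
    evP F (m + 1) f = glue a b :=
  eq_glue_iff.2 ⟨funext ha, funext hb⟩

/-- By homogeneity `lead Q ^ (d + 1)` restores the value at `Q` from that at its representative;
positive degree takes care of the origin. -/
theorem spread_evP {g : MvPolynomial (Fin (m + 1)) F} (hg : g.IsHomogeneous (d + 1)) :
    spread (d + 1) (evP F m g) = evA F (m + 1) g := by
  funext Q
  change _ = eval Q g
  rw [spread]
  split_ifs with h
  · rw [h, eval_zero_of_isHomogeneous hg (Nat.succ_ne_zero d)]
  · change lead Q ^ (d + 1) * eval ((lead Q)⁻¹ • Q) g = eval Q g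
    rw [← eval_smul_of_isHomogeneous hg, smul_inv_smul₀ (lead_ne_zero h)]

/-- The affine polynomial has degree at most `d`, so its homogenization to degree `d + 1` vanishes
at infinity and leaves only `g` there. -/
theorem secondPart_isSound {A : AffDecoder F (m + 1)} {P : ProjDecoder F m}
    (hA : ∀ r c f, A r = some (c, f) → f.totalDegree ≤ d ∧ evA F (m + 1) f = c)
    (hP : IsSound (d + 1) P) : IsSound (d + 1) (secondPart (d + 1) A P) := by
  intro r c f h
  simp only [secondPart, Option.bind_eq_some_iff, Option.some.injEq, Prod.mk.injEq,
    Prod.exists] at h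
  obtain ⟨v, g, hvg, u, f₀, huf, rfl, rfl⟩ := h
  obtain ⟨hg, rfl⟩ := hP _ _ _ hvg
  obtain ⟨hf₀, rfl⟩ := hA _ _ _ huf
  have hf₀' := hf₀.trans (Nat.le_succ d)
  refine ⟨(isHomogeneous_homog hf₀').add hg.rename_isHomogeneous,
    evP_eq_glue (fun y => ?_) fun Q => ?_⟩
  · rw [map_add, eval_homog_one, eval_cons_rename_succ, spread_evP hg]
    rfl
  · rw [map_add, eval_homog_zero hf₀', eval_cons_rename_succ,
      homogeneousComponent_eq_zero _ _ (Nat.lt_succ_of_le hf₀), map_zero, zero_add]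
    rfl

/-- Uniqueness of decoding within half the distance; it validates any codeword that passes the test
after the first part. -/
theorem eq_of_hammingNorm_lt {ι : Type*} [Fintype ι] {C : Submodule F (ι → F)} {c c' e : ι → F}
    (hc : c ∈ C) (hc' : c' ∈ C) (he : 2 * hammingNorm e < minDist C)
    (he' : 2 * hammingNorm (c + e - c') < minDist C) : c' = c := by
  by_contra hne
  have h1 : minDist C ≤ hammingNorm (c' - c) :=
    Nat.sInf_le ⟨c' - c, C.sub_mem hc' hc, sub_ne_zero.2 hne, rfl⟩
  have h2 : hammingNorm (c' - c) ≤ hammingNorm e + hammingNorm (c + e - c') := by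
    have h3 := hammingDist_triangle c (c + e) c'
    rw [hammingDist_comm (c + e) c'] at h3
    simp only [hammingDist_eq_hammingNorm] at h3
    rwa [neg_add_cancel_left, neg_add_eq_sub, neg_add_eq_sub] at h3
  omega

variable [Fintype F]

theorem evP_firstPart {e : ℕ} {f₀ fbad : MvPolynomial (Fin (m + 1)) F}
    (hf₀ : f₀.totalDegree ≤ e + 1 + (Fintype.card F - 1)) (hbad : fbad.IsHomogeneous (e + 1))
    (hd : d = e + 1 + (Fintype.card F - 1)) :
    (homog d (reduce (f₀ - fbad - goodTop d f₀)) + rename Fin.succ (raise d fbad) +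
      rename Fin.succ (goodTop d f₀)).IsHomogeneous d ∧
    evP F (m + 1) (homog d (reduce (f₀ - fbad - goodTop d f₀)) + rename Fin.succ (raise d fbad) +
      rename Fin.succ (goodTop d f₀)) =
      glue (evA F (m + 1) f₀) (evP F m (goodTop d f₀) + evP F m fbad) := by
  have hq := two_le_card (F := F)
  rw [← hd] at hf₀
  have htop : (goodTop d f₀).IsHomogeneous d := homogeneousComponent_isHomogeneous _ _
  -- Subtracting the top component leaves degree below `d`, so this summand contributes nothing at
  -- infinity. On the affine part the subtracted polynomials are added back.
  have hlt : (reduce (f₀ - fbad - goodTop d f₀)).totalDegree < d := by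
    refine (totalDegree_reduce_le _).trans_lt
      (totalDegree_lt_of_homogeneousComponent_eq_zero (by omega) ?_ ?_)
    · refine (totalDegree_sub _ _).trans (max_le ((totalDegree_sub _ _).trans
        (max_le hf₀ (hbad.totalDegree_le.trans (by omega)))) htop.totalDegree_le)
    · rw [map_sub, map_sub, homogeneousComponent_eq_self htop, goodTop_eq,
        homogeneousComponent_eq_zero _ fbad (hbad.totalDegree_le.trans_lt (by omega)), sub_zero,
        sub_self]
  refine ⟨((isHomogeneous_homog hlt.le).add
    (isHomogeneous_raise hbad (by omega)).rename_isHomogeneous).add htop.rename_isHomogeneous,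
    evP_eq_glue (fun y => ?_) fun Q => ?_⟩
  · rw [map_add, map_add, eval_homog_one, eval_cons_rename_succ, eval_cons_rename_succ,
      eval_reduce, hd, eval_raise hbad, map_sub, map_sub]
    change _ = eval y f₀
    ring
  · rw [map_add, map_add, eval_homog_zero hlt.le, eval_cons_rename_succ, eval_cons_rename_succ,
      homogeneousComponent_eq_zero _ _ hlt, hd, eval_raise hbad, map_zero, zero_add, add_comm]
    rfl

theorem firstPart_isSound {A : AffDecoder F (m + 1)} {P : ProjDecoder F m}
    (hA : ∀ r c f, A r = some (c, f) → f.totalDegree ≤ d ∧ evA F (m + 1) f = c)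
    (hP : ¬ d ≤ Fintype.card F - 1 → IsSound (d - (Fintype.card F - 1)) P) :
    IsSound d (firstPart d A P) := by
  intro r c f h
  simp only [firstPart, Option.bind_eq_some_iff, Prod.exists] at h
  obtain ⟨c₁, f₀, hA₀, h⟩ := h
  obtain ⟨hf₀, rfl⟩ := hA _ _ _ hA₀
  split_ifs at h with hd
  · simp only [Option.some.injEq, Prod.mk.injEq] at h
    obtain ⟨rfl, rfl⟩ := h
    exact ⟨isHomogeneous_homog hf₀, rfl⟩
  · simp only [Option.bind_eq_some_iff, Prod.exists, Option.some.injEq, Prod.mk.injEq] at h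
    obtain ⟨cbad, fbad, hPb, rfl, rfl⟩ := h
    obtain ⟨hbad, rfl⟩ := hP hd _ _ _ hPb
    obtain ⟨e, rfl⟩ : ∃ e, d = e + 1 + (Fintype.card F - 1) :=
      ⟨d - (Fintype.card F - 1) - 1, by omega⟩
    rw [Nat.add_sub_cancel] at hbad
    exact evP_firstPart hf₀ hbad rfl

theorem decode_isSound {D : (j e : ℕ) → AffDecoder F j}
    (hD : ∀ j e, 1 ≤ j → j ≤ m → e ≤ d + 1 → IsRMDecoder e j (D j e)) :
    IsSound (d + 1) (decode D m (d + 1)) := by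
  induction m generalizing d with
  | zero =>
    rw [decode]
    exact direct_isSound 0 _
  | succ m ih =>
    have h₂ : IsSound (d + 1) (secondPart (d + 1) (D (m + 1) d) (decode D m (d + 1))) :=
      secondPart_isSound (hD (m + 1) d (by omega) le_rfl (by omega)).returns
        (ih fun j e h1 h2 h3 => hD j e h1 (by omega) h3)
    intro r c f h
    rw [decode] at h
    split_ifs at h with ht
    · exact direct_isSound _ _ _ _ _ h
    · beta_reduce at h
      split at h
      · rename_i c' f' h'
        split_ifs at h with hw
        · simp only [Option.some.injEq, Prod.mk.injEq] at h
          obtain ⟨rfl, rfl⟩ := h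
          refine firstPart_isSound (hD (m + 1) (d + 1) (by omega) le_rfl le_rfl).returns
            (fun hd => ?_) _ _ _ h'
          -- The recursive call is made only for `d + 1 > q - 1`, so its degree is again positive.
          rw [show d + 1 - (Fintype.card F - 1) = (d - (Fintype.card F - 1)) + 1 by omega]
          exact ih fun j e h1 h2 h3 => hD j e h1 (by omega) (by omega)
        · exact h₂ _ _ _ h
      · exact h₂ _ _ _ h

/-- Once the part at infinity is known, subtracting its extension turns the affine part into `f(1,
y) - f(0, y)`, a word of `RM_d(m+1)` with the same affine error. -/
theorem secondPart_corrects {A : AffDecoder F (m + 1)} {P : ProjDecoder F m}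
    (hA : IsRMDecoder d (m + 1) A) {c e : ProjWord F (m + 1)} (hc : c ∈ PRM F (d + 1) (m + 1))
    (he : 2 * hammingNorm (fstPart e) < minDist (RM F d (m + 1)))
    (hP : ∃ g, P (sndPart c + sndPart e) = some (sndPart c, g)) :
    ∃ f, secondPart (d + 1) A P (c + e) = some (c, f) := by
  obtain ⟨f, hf, rfl⟩ := mem_PRM.1 hc
  obtain ⟨g, hg⟩ := hP
  obtain ⟨f', hf', hff'⟩ := exists_isHomogeneous_slice_zero hf
  have hsnd : sndPart (evP F (m + 1) f) = evP F m f' := funext fun Q => (hff' Q.1).symm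
  have hmem : fstPart (evP F (m + 1) f) - spread (d + 1) (sndPart (evP F (m + 1) f)) ∈
      RM F d (m + 1) := by
    have := sub_slices_mem_RM hf
    simp only [← hff'] at this
    rw [hsnd, spread_evP hf']
    exact this
  obtain ⟨f₀, hf₀⟩ := hA.corrects _ hmem _ he
  have hfst : fstPart (evP F (m + 1) f + e) - spread (d + 1) (sndPart (evP F (m + 1) f)) =
      fstPart (evP F (m + 1) f) - spread (d + 1) (sndPart (evP F (m + 1) f)) + fstPart e :=
    add_sub_right_comm _ _ _
  refine ⟨homog (d + 1) f₀ + rename Fin.succ g, ?_⟩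
  simp only [secondPart]
  rw [show sndPart (evP F (m + 1) f + e) = sndPart (evP F (m + 1) f) + sndPart e from rfl, hg,
    Option.bind_some]
  dsimp only
  rw [hfst, hf₀, Option.bind_some, sub_add_cancel, glue_parts]

/-- The returned polynomial `f₀` and the dehomogenization `f'` of the codeword agree on affine
space. If `d < q` they are equal. Otherwise their top components differ, as functions, by a form of
degree `d - (q - 1)`, so the second decoder receives a word of that code plus the error at infinity.
-/
theorem firstPart_corrects {A : AffDecoder F (m + 1)} {P : ProjDecoder F m}
    (hA : IsRMDecoder d (m + 1) A) {c e : ProjWord F (m + 1)} (hc : c ∈ PRM F d (m + 1))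
    (he : 2 * hammingNorm (fstPart e) < minDist (RM F d (m + 1)))
    (hP : ¬ d ≤ Fintype.card F - 1 → ∀ b ∈ PRM F (d - (Fintype.card F - 1)) m,
      ∃ g, P (b + sndPart e) = some (b, g)) :
    ∃ f, firstPart d A P (c + e) = some (c, f) := by
  have hq := two_le_card (F := F)
  obtain ⟨f, hf, rfl⟩ := mem_PRM.1 hc
  obtain ⟨f', hf', hf1, hf0⟩ := exists_dehomogenization hf
  have hfst : fstPart (evP F (m + 1) f) = evA F (m + 1) f' := funext fun y => (hf1 y).symm
  have hmem : fstPart (evP F (m + 1) f) ∈ RM F d (m + 1) :=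
    mem_RM.2 ⟨f', hf', fun y => congrFun hfst.symm y⟩
  obtain ⟨f₀, hAf⟩ := hA.corrects _ hmem _ he
  obtain ⟨hf₀, hf₀e⟩ := hA.returns _ _ _ hAf
  have hdiff : ∀ y, eval y (f' - f₀) = 0 := fun y => by
    rw [map_sub, sub_eq_zero]
    exact (congrFun (hf₀e.trans hfst) y).symm
  have hdeg : (f' - f₀).totalDegree ≤ d := (totalDegree_sub _ _).trans (max_le hf' hf₀)
  simp only [firstPart]
  rw [show fstPart (evP F (m + 1) f + e) = fstPart (evP F (m + 1) f) + fstPart e from rfl, hAf,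
    Option.bind_some]
  dsimp only
  split_ifs with hd
  · refine ⟨homog d f₀, ?_⟩
    have h0 := sub_eq_zero.1 (eq_zero_of_totalDegree_lt_card (by omega) hdiff)
    have : evP F (m + 1) (homog d f₀) = evP F (m + 1) f := by
      rw [← glue_parts (evP F (m + 1) f)]
      refine evP_eq_glue (fun y => ?_) fun Q => ?_
      · rw [eval_homog_one, ← h0]
        exact hf1 y
      · rw [eval_homog_zero hf₀, ← h0]
        exact hf0 Q.1
    rw [this]
  · obtain ⟨k, rfl⟩ : ∃ k, d = k + Fintype.card F := ⟨d - Fintype.card F, by omega⟩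
    obtain ⟨b, hb, hbe⟩ := exists_isHomogeneous_eval_homogeneousComponent hdeg hdiff
    have hsub : sndPart (evP F (m + 1) f) - evP F m (goodTop (k + Fintype.card F) f₀) =
        evP F m b := by
      funext Q
      rw [goodTop_eq]
      change eval (Fin.cons 0 Q.1) f - eval Q.1 _ = eval Q.1 b
      rw [hbe, map_sub, map_sub, hf0]
    obtain ⟨g, hg⟩ := hP hd (evP F m b) (mem_PRM.2 ⟨b, by
      rwa [show k + Fintype.card F - (Fintype.card F - 1) = k + 1 by omega], rfl⟩)
    rw [show sndPart (evP F (m + 1) f + e) - evP F m (goodTop (k + Fintype.card F) f₀) =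
      evP F m b + sndPart e by rw [← hsub]; exact add_sub_right_comm _ _ _, hg, Option.bind_some]
    dsimp only
    rw [← hsub, add_sub_cancel, glue_parts]
    exact ⟨_, rfl⟩

/-- Induction on `m` for all `d`, with the alternative in `hcond` stable under both recursive calls.
Which part succeeds depends on whether the affine error is within the capability of `RM_{d+1}(m+1)`.
-/
theorem decode_corrects {D : (j e : ℕ) → AffDecoder F j}
    (hcond : d % (Fintype.card F - 1) = 0 ∨ (m - 1) * (Fintype.card F - 1) ≤ d)
    (hD : ∀ j e, 1 ≤ j → j ≤ m → e ≤ d + 1 → IsRMDecoder e j (D j e))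
    {c e : ProjWord F m} (hc : c ∈ PRM F (d + 1) m)
    (he : 2 * hammingNorm e < minDist (PRM F (d + 1) m)) :
    ∃ f, decode D m (d + 1) (c + e) = some (c, f) := by
  have hq := two_le_card (F := F)
  induction m generalizing d with
  | zero =>
    rw [minDist_PRM, rmWeight] at he
    have he0 : e = 0 := hammingNorm_eq_zero.1 (by omega)
    rw [decode, he0, add_zero]
    exact direct_eq_some hc
  | succ m ih =>
    rw [decode]
    split_ifs with ht
    · have he0 : e = 0 := hammingNorm_eq_zero.1 (by omega)
      rw [he0, add_zero]
      exact direct_eq_some hc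
    · have hparts := hammingNorm_eq_parts e
      have hA₁ := hD (m + 1) (d + 1) (by omega) le_rfl le_rfl
      have hA₂ := hD (m + 1) d (by omega) le_rfl (by omega)
      have hPsound : ¬ d + 1 ≤ Fintype.card F - 1 → IsSound (d + 1 - (Fintype.card F - 1))
          (decode D m (d + 1 - (Fintype.card F - 1))) := by
        intro hd
        rw [show d + 1 - (Fintype.card F - 1) = (d - (Fintype.card F - 1)) + 1 by omega]
        exact decode_isSound fun j e h1 h2 h3 => hD j e h1 (by omega) (by omega)
      have hfirst : 2 * hammingNorm (fstPart e) < minDist (RM F (d + 1) (m + 1)) →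
          ∃ f, firstPart (d + 1) (D (m + 1) (d + 1))
            (decode D m (d + 1 - (Fintype.card F - 1))) (c + e) = some (c, f) := by
        intro h
        refine firstPart_corrects hA₁ hc h fun hd b hb => ?_
        obtain ⟨k, rfl⟩ : ∃ k, d = k + (Fintype.card F - 1) :=
          ⟨d - (Fintype.card F - 1), by omega⟩
        rw [show k + (Fintype.card F - 1) + 1 - (Fintype.card F - 1) = k + 1 by omega] at hb ⊢
        refine ih ?_ (fun j e h1 h2 h3 => hD j e h1 (by omega) (by omega)) hb ?_
        · refine hcond.imp (fun h => by rwa [Nat.add_mod_right] at h) fun h => ?_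
          rw [Nat.add_sub_cancel] at h
          rw [Nat.sub_mul]
          omega
        -- Lowering the degree by `q - 1` and the dimension by one keeps the distance, so the whole
        -- error weight is allowed at infinity.
        · rw [minDist_PRM, rmWeight_add] at he
          rw [minDist_PRM]
          omega
      have hsecond : ¬ 2 * hammingNorm (fstPart e) < minDist (RM F (d + 1) (m + 1)) →
          ∃ f, secondPart (d + 1) (D (m + 1) d) (decode D m (d + 1)) (c + e) = some (c, f) := by
        intro h
        rw [minDist_PRM] at he
        refine secondPart_corrects hA₂ hc (by rw [minDist_RM]; omega) ?_
        obtain ⟨f, hf, rfl⟩ := mem_PRM.1 hc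
        obtain ⟨f', hf', hff'⟩ := exists_isHomogeneous_slice_zero hf
        have hmem : sndPart (evP F (m + 1) f) ∈ PRM F (d + 1) m :=
          mem_PRM.2 ⟨f', hf', funext fun Q => hff' Q.1⟩
        refine ih ?_ (fun j e h1 h2 h3 => hD j e h1 (by omega) h3) hmem ?_
        · refine hcond.imp_right fun h => le_trans (Nat.mul_le_mul_right _ ?_) h
          omega
        -- The affine error takes at least half of `wt(RM_{d+1}(m+1))`, so what remains is less than
        -- half of `wt(PRM_{d+1}(m))`.
        · have := rmWeight_le_add hq d m hcond
          rw [minDist_RM] at h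
          rw [minDist_PRM]
          omega
      beta_reduce
      by_cases h : 2 * hammingNorm (fstPart e) < minDist (RM F (d + 1) (m + 1))
      · obtain ⟨f, hf⟩ := hfirst h
        refine ⟨f, ?_⟩
        rw [hf]
        simp only [add_sub_cancel_left]
        rw [if_pos he]
      -- The first part has no guarantee here, but a pair that passes the test must have first entry
      -- `c`.
      · split
        · rename_i c' f' h'
          split_ifs with hw
          · obtain ⟨hf', hc'⟩ := firstPart_isSound hA₁.returns hPsound _ _ _ h'
            have := eq_of_hammingNorm_lt hc (mem_PRM.2 ⟨f', hf', hc'⟩) he hw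
            exact ⟨f', by rw [this]⟩
          · exact hsecond h
        · exact hsecond h

end Decoder

end ProjReedMuller

/-! ### The value of `η` and the theorem. -/

theorem lemma2p5 {F : Type*} [Field F] [Fintype F] [DecidableEq F] (q m d ν μ : ℕ)
    (hq : q = Fintype.card F) (hd1 : 1 ≤ d) (hdm : d ≤ m * (q - 1))
    (hd : d - 1 = ν * (q - 1) + μ) (hμ : μ < q - 1) :
    ((eta F d m : ℚ) = ((q : ℚ) - μ) * (q : ℚ) ^ (m - ν - 1)
        - μ * (((q : ℚ) ^ (m - ν - 1) - 1) / ((q : ℚ) - 1))) ∧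
    ((eta F d m : ℚ) = (minDist (PRM F d m) : ℚ)
        - μ * (((q : ℚ) ^ (m - ν - 1) - 1) / ((q : ℚ) - 1))) ∧
    eta F d m ≤ minDist (PRM F d m) ∧
    (eta F d m = minDist (PRM F d m) ↔ μ = 0 ∨ ν = m - 1) ∧
    ((μ = 0 ∨ ν = m - 1) →
      ∀ D : (j e : ℕ) → AffDecoder F j,
        (∀ j e : ℕ, 1 ≤ j → j ≤ m → e ≤ d → IsRMDecoder e j (D j e)) →
        ∀ c ∈ PRM F d m, ∀ e : ProjWord F m,
          hammingNorm e ≤ (minDist (PRM F d m) - 1) / 2 →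
          ∃ f : MvPolynomial (Fin (m + 1)) F,
            decode D m d (c + e) = some (c, f) ∧ f.IsHomogeneous d ∧ evP F m f = c) := by
  have hq2 : 2 ≤ q := hq ▸ two_le_card
  -- From here on `d` stands for the former `d - 1`.
  obtain ⟨d, rfl⟩ := Nat.exists_eq_add_of_le' hd1
  rw [Nat.add_sub_cancel] at hd
  have hνm : ν < m := by
    by_contra h
    have : m * (q - 1) ≤ ν * (q - 1) := Nat.mul_le_mul_right _ (not_lt.1 h)
    omega
  obtain ⟨M, rfl⟩ := Nat.exists_eq_add_of_lt hνm
  rw [show ν + M + 1 - ν - 1 = M by omega]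
  have hdiv : d / (q - 1) = ν := by
    rw [hd, Nat.mul_comm, Nat.mul_add_div (by omega), Nat.div_eq_of_lt hμ, add_zero]
  have hmod : d % (q - 1) = μ := by
    rw [hd, Nat.mul_comm, Nat.mul_add_mod, Nat.mod_eq_of_lt hμ]
  have hdist : minDist (PRM F (d + 1) (ν + M + 1)) = (q - μ) * q ^ M := by
    rw [minDist_PRM, ← hq, hd, show ν + M + 1 = ν + 1 + M by ring, rmWeight_eq hq2 hμ.le]
  have hq1 : (q : ℚ) - 1 ≠ 0 := by
    have : (2 : ℚ) ≤ q := by exact_mod_cast hq2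
    linarith
  have heta : eta F (d + 1) (ν + M + 1) =
      ∑ i ∈ Finset.range (M + 1), (q - (μ + 1)) * q ^ i + 1 := by
    rw [eta, Nat.add_sub_cancel, ← hq, hdiv, show ν + M + 1 - ν = M + 1 by omega,
      ← Finset.sum_range_reflect]
    congr 1
    -- In reversed order the summands are `wt(RM_{d+1}(ν + 1 + i))`, with remainder `μ + 1 ≤ q - 1`.
    refine Finset.sum_congr rfl fun i hi => ?_
    rw [Finset.mem_range] at hi
    rw [minDist_RM, ← hq, hd, show ν + M + 1 - (M + 1 - 1 - i) = ν + 1 + i by omega, add_assoc,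
      rmWeight_eq hq2 hμ]
  have hdistQ : (minDist (PRM F (d + 1) (ν + M + 1)) : ℚ) = ((q : ℚ) - μ) * (q : ℚ) ^ M := by
    rw [hdist]
    push_cast [Nat.cast_sub (show μ ≤ q by omega)]
    ring
  have hetaQ : (eta F (d + 1) (ν + M + 1) : ℚ) = ((q : ℚ) - μ) * (q : ℚ) ^ M
      - μ * (((q : ℚ) ^ M - 1) / ((q : ℚ) - 1)) := by
    rw [heta, ← Finset.mul_sum]
    push_cast [Nat.cast_sub (show μ + 1 ≤ q by omega)]
    rw [geom_sum_eq (sub_ne_zero.1 hq1)]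
    field_simp
    ring
  have hdefect : 0 ≤ ((q : ℚ) ^ M - 1) / ((q : ℚ) - 1) := by
    have h1 : (1 : ℚ) ≤ q := by exact_mod_cast (by omega : 1 ≤ q)
    exact div_nonneg (sub_nonneg.2 (one_le_pow₀ h1)) (sub_nonneg.2 h1)
  refine ⟨hetaQ, by rw [hdistQ, hetaQ], ?_, ?_, ?_⟩
  · rw [← Nat.cast_le (α := ℚ), hetaQ, hdistQ]
    have : (0 : ℚ) ≤ μ * (((q : ℚ) ^ M - 1) / ((q : ℚ) - 1)) :=
      mul_nonneg (Nat.cast_nonneg μ) hdefect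
    linarith
  · rw [← Nat.cast_inj (R := ℚ), hetaQ, hdistQ, sub_eq_self, mul_eq_zero, div_eq_zero_iff,
      or_iff_left hq1, Nat.cast_eq_zero, sub_eq_zero]
    refine or_congr_right ?_
    rw [← Nat.cast_pow, Nat.cast_eq_one, Nat.pow_eq_one]
    omega
  · intro hcase D hD c hc e he
    -- Positivity of the distance makes the truncated `(w - 1) / 2` bound equivalent to `2 * wt(e) <
    -- w`.
    have hpos := rmWeight_pos hq2 d (ν + M + 1)
    rw [hq, ← minDist_PRM] at hpos
    have hcond : d % (Fintype.card F - 1) = 0 ∨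
        (ν + M + 1 - 1) * (Fintype.card F - 1) ≤ d := by
      rw [← hq, hmod]
      refine hcase.imp_right fun h => ?_
      rw [← h, hd]
      omega
    obtain ⟨f, hf⟩ := decode_corrects hcond hD hc (by omega : 2 * hammingNorm e < _)
    exact ⟨f, hf, decode_isSound hD _ _ _ hf⟩
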